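/- Let $\alpha\in(1,2)$, $\beta>0$ and $C_0>0$, and let $J$ be a symmetric real random variable (that is, $J$ and $-J$ have the same distribution) with $$\mathbb P(|J|\ge t)=\frac{C_0}{t^{\alpha}}\qquad\text{for all } t>1 .$$ For each $N\ge 1$ let $(J_{ij})_{1\le i<j\le N}$ be independent random variables with the same distribution as $J$, and define $$H_N(\sigma)=\frac1{N^{1/\alpha}}\sum_{1\le i<j\le N}J_{ij}\sigma_i\sigma_j\quad(\sigma\in\{-1,+1\}^N),\qquad Z_N(\beta)=\sum_{\sigma\in\{-1,+1\}^N}e^{\beta H_N(\sigma)},\qquad F_N(\beta)=\frac1N\,\mathbb E\big[\log Z_N(\beta)\big].$$ Then $\log Z_N(\beta)$ is integrable for every $N$, and the limit $\lim_{N\to\infty}F_N(\beta)$ exists and is finite. -/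

import Mathlib

open MeasureTheory ProbabilityTheory Filter Topology

noncomputable section

namespace HeavyTailedSpinGlass

/-- The pairs `(i, j)` of sites with `i < j`. -/
abbrev Pairs (N : ℕ) : Type := {p : Fin N × Fin N // p.1 < p.2}

/-- Spin configurations `Σ_N = {-1, +1}^N`; the units of `ℤ` are exactly `-1` and `1`. -/
abbrev Config (N : ℕ) : Type := Fin N → ℤˣ

/-- The value `±1` of the spin at site `i`, as a real number. -/
def spin {N : ℕ} (σ : Config N) (i : Fin N) : ℝ := ((σ i : ℤ) : ℝ)

/-- The Hamiltonian `H(σ) = N^{-1/α} ∑_{i<j} J_{ij} σ_i σ_j`. -/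
def hamiltonian (α : ℝ) {N : ℕ} (J : Pairs N → ℝ) (σ : Config N) : ℝ :=
  1 / (N : ℝ) ^ (1 / α) * ∑ p : Pairs N, J p * spin σ p.1.1 * spin σ p.1.2

/-- The partition function `Z_N(β) = ∑_σ exp (β H(σ))`. -/
def partitionFunction (α β : ℝ) {N : ℕ} (J : Pairs N → ℝ) : ℝ :=
  ∑ σ : Config N, Real.exp (β * hamiltonian α J σ)

/-- The quenched free energy `F_N(β) = N⁻¹ 𝔼[log Z_N(β)]` for random couplings `J`. -/
def freeEnergy (α β : ℝ) {N : ℕ} {Ω : Type*} [MeasurableSpace Ω] (P : Measure Ω)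
    (J : Pairs N → Ω → ℝ) : ℝ :=
  1 / (N : ℝ) * ∫ ω, Real.log (partitionFunction α β (fun p => J p ω)) ∂P

end HeavyTailedSpinGlass

end

/-!
Switching on a symmetric coupling `y` of a pair whose Gibbs correlation is `m` raises the mean of
`log Z` by `gain y m`, so interpolating between two product laws changes the mean of `log Z` at a
rate that compares the averaged gains. As `0 ≤ gain y m ≤ y ^ 2 / 2`, deleting the couplings below
a threshold `δ` costs only `O(δ ^ (2 - α))` per site. What remains is, for large `N`, exactly a
diluted model: a pair is coupled with probability `c / N`, by a conditional law that does not
depend on `N`. The diluted model is superadditive up to a constant, as in the interpolation of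
Franz and Leone: merging two blocks changes the densities by at least `-K u i * u j` with
`∑ u i = 0`, and `gain y` of the Gibbs correlations is conditionally negative definite, being a
constant minus a power series with nonnegative coefficients in `(tanh y * m) ^ 2`. Hence each
diluted free energy converges, and the original one is Cauchy.
-/

noncomputable section

namespace HeavyTailedSpinGlass

/-! ### The partition function as a function of the couplings -/

section PartitionFunction

variable {N : ℕ}

lemma spin_eq_one_or (σ : Config N) (i : Fin N) : spin σ i = 1 ∨ spin σ i = -1 := by
  rcases Int.units_eq_one_or (σ i) with h | h <;> simp [spin, h]

lemma spin_mul_self (σ : Config N) (i : Fin N) : spin σ i * spin σ i = 1 := by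
  rcases spin_eq_one_or σ i with h | h <;> simp [h]

lemma spin_mul_spin_eq_one_or (σ : Config N) (i j : Fin N) :
    spin σ i * spin σ j = 1 ∨ spin σ i * spin σ j = -1 := by
  rcases spin_eq_one_or σ i with h | h <;> rcases spin_eq_one_or σ j with h' | h' <;> simp [h, h']

lemma abs_spin_mul_spin (σ : Config N) (i j : Fin N) : |spin σ i * spin σ j| = 1 := by
  rcases spin_mul_spin_eq_one_or σ i j with h | h <;> simp [h]

/-- The unnormalized energy `∑_{i<j} x_{ij} σ_i σ_j`; the factor `β N^{-1/α}` is absorbed in the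
couplings `x`. -/
def energy (x : Pairs N → ℝ) (σ : Config N) : ℝ :=
  ∑ p : Pairs N, x p * (spin σ p.1.1 * spin σ p.1.2)

/-- The log-partition function `log ∑_σ exp (∑_{i<j} x_{ij} σ_i σ_j)` of the couplings `x`. -/
def logZ (x : Pairs N → ℝ) : ℝ := Real.log (∑ σ : Config N, Real.exp (energy x σ))

/-- The Gibbs average of `σ_i σ_j` under the couplings `x`. -/
def gibbs (x : Pairs N → ℝ) (i j : Fin N) : ℝ :=
  (∑ σ : Config N, Real.exp (energy x σ) * (spin σ i * spin σ j)) /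
    ∑ σ : Config N, Real.exp (energy x σ)

lemma log_partitionFunction (α β : ℝ) (J : Pairs N → ℝ) :
    Real.log (partitionFunction α β J) = logZ fun p => ((N : ℝ) ^ (1 / α))⁻¹ * (β * J p) := by
  unfold partitionFunction logZ energy hamiltonian
  congr! 3 with σ
  rw [Finset.mul_sum, Finset.mul_sum]
  refine Finset.sum_congr rfl fun p _ => ?_
  ring

lemma sum_exp_energy_pos (x : Pairs N → ℝ) : 0 < ∑ σ : Config N, Real.exp (energy x σ) :=
  Finset.sum_pos (fun _ _ => Real.exp_pos _) Finset.univ_nonempty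

@[fun_prop]
lemma continuous_energy (σ : Config N) : Continuous fun x : Pairs N → ℝ => energy x σ := by
  unfold energy
  fun_prop

@[fun_prop]
lemma continuous_logZ : Continuous (logZ (N := N)) := by
  unfold logZ
  exact Continuous.log (by fun_prop) fun x => (sum_exp_energy_pos x).ne'

@[fun_prop]
lemma continuous_gibbs (i j : Fin N) : Continuous fun x : Pairs N → ℝ => gibbs x i j := by
  unfold gibbs
  exact Continuous.div (by fun_prop) (by fun_prop) fun x => (sum_exp_energy_pos x).ne'

lemma energy_le_add_sum_abs_sub (x x' : Pairs N → ℝ) (σ : Config N) :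
    energy x σ ≤ energy x' σ + ∑ p, |x p - x' p| := by
  unfold energy
  rw [← Finset.sum_add_distrib]
  refine Finset.sum_le_sum fun p _ => ?_
  have h := le_abs_self ((x p - x' p) * (spin σ p.1.1 * spin σ p.1.2))
  rw [abs_mul, abs_spin_mul_spin, mul_one] at h
  linarith

lemma logZ_le_add_sum_abs_sub (x x' : Pairs N → ℝ) : logZ x ≤ logZ x' + ∑ p, |x p - x' p| := by
  unfold logZ
  rw [Real.log_le_iff_le_exp (sum_exp_energy_pos x), Real.exp_add,
    Real.exp_log (sum_exp_energy_pos x'), Finset.sum_mul]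
  refine Finset.sum_le_sum fun σ _ => ?_
  rw [← Real.exp_add]
  exact Real.exp_le_exp.2 (energy_le_add_sum_abs_sub x x' σ)

lemma abs_logZ_sub_le (x x' : Pairs N → ℝ) : |logZ x - logZ x'| ≤ ∑ p, |x p - x' p| := by
  have h := logZ_le_add_sum_abs_sub x' x
  simp only [abs_sub_comm (x' _)] at h
  rw [abs_sub_le_iff]
  constructor <;> linarith [logZ_le_add_sum_abs_sub x x']

lemma logZ_zero : logZ (0 : Pairs N → ℝ) = N * Real.log 2 := by
  simp [logZ, energy, Config]

lemma gibbs_comm (x : Pairs N → ℝ) (i j : Fin N) : gibbs x i j = gibbs x j i := by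
  simp only [gibbs, mul_comm (spin _ i)]

lemma gibbs_self (x : Pairs N → ℝ) (i : Fin N) : gibbs x i i = 1 := by
  simp only [gibbs, spin_mul_self, mul_one]
  exact div_self (sum_exp_energy_pos x).ne'

lemma abs_gibbs_le_one (x : Pairs N → ℝ) (i j : Fin N) : |gibbs x i j| ≤ 1 := by
  unfold gibbs
  rw [abs_div, abs_of_pos (sum_exp_energy_pos x), div_le_one (sum_exp_energy_pos x)]
  refine (Finset.abs_sum_le_sum_abs _ _).trans_eq (Finset.sum_congr rfl fun σ _ => ?_)
  rw [abs_mul, abs_spin_mul_spin, mul_one, Real.abs_exp]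

lemma energy_update (x : Pairs N → ℝ) (e : Pairs N) (y : ℝ) (σ : Config N) :
    energy (Function.update x e y) σ =
      energy (Function.update x e 0) σ + y * (spin σ e.1.1 * spin σ e.1.2) := by
  rw [← sub_eq_iff_eq_add']
  unfold energy
  rw [← Finset.sum_sub_distrib, Finset.sum_eq_single e]
  · simp
  · intro p _ hp
    simp [hp]
  · simp

lemma exp_mul_spin_mul_spin (σ : Config N) (i j : Fin N) (y : ℝ) :
    Real.exp (y * (spin σ i * spin σ j)) =
      Real.cosh y + spin σ i * spin σ j * Real.sinh y := by
  rcases spin_mul_spin_eq_one_or σ i j with h | h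
  · rw [h, mul_one, one_mul, Real.cosh_add_sinh]
  · rw [h, mul_neg_one, neg_one_mul, ← sub_eq_add_neg, Real.cosh_sub_sinh]

lemma cosh_add_mul_sinh_pos {m : ℝ} (hm : |m| ≤ 1) (y : ℝ) :
    0 < Real.cosh y + m * Real.sinh y := by
  have hexp : Real.cosh y + m * Real.sinh y =
      (1 + m) / 2 * Real.exp y + (1 - m) / 2 * Real.exp (-y) := by
    rw [← Real.cosh_add_sinh y, ← Real.cosh_sub_sinh y]
    ring
  obtain ⟨hm₁, hm₂⟩ := abs_le.1 hm
  rw [hexp]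
  rcases lt_or_ge m 0 with h | h
  · have := mul_nonneg (by linarith : 0 ≤ (1 + m) / 2) (Real.exp_pos y).le
    have := mul_pos (by linarith : 0 < (1 - m) / 2) (Real.exp_pos (-y))
    linarith
  · have := mul_pos (by linarith : 0 < (1 + m) / 2) (Real.exp_pos y)
    have := mul_nonneg (by linarith : 0 ≤ (1 - m) / 2) (Real.exp_pos (-y)).le
    linarith

lemma logZ_update (x : Pairs N → ℝ) (e : Pairs N) (y : ℝ) :
    logZ (Function.update x e y) = logZ (Function.update x e 0) +
      Real.log (Real.cosh y + gibbs (Function.update x e 0) e.1.1 e.1.2 * Real.sinh y) := by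
  have hZ := sum_exp_energy_pos (Function.update x e 0)
  have hpos := cosh_add_mul_sinh_pos (abs_gibbs_le_one (Function.update x e 0) e.1.1 e.1.2) y
  unfold logZ
  rw [← Real.log_mul hZ.ne' hpos.ne', mul_add, gibbs, ← mul_assoc, mul_div_cancel₀ _ hZ.ne',
    Finset.sum_mul, Finset.sum_mul, ← Finset.sum_add_distrib]
  congr! 2 with σ
  rw [energy_update, Real.exp_add, exp_mul_spin_mul_spin]
  ring

end PartitionFunction

/-! ### The symmetrized gain from a single coupling -/

section Gain

/-- The effect on `logZ`, averaged over the sign, of a new coupling `±y` between two spins whose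
Gibbs correlation is `m`. -/
def gain (y m : ℝ) : ℝ := Real.log (Real.cosh y ^ 2 - m ^ 2 * Real.sinh y ^ 2) / 2

variable {m : ℝ}

lemma one_le_cosh_sq_sub (hm : |m| ≤ 1) (y : ℝ) :
    1 ≤ Real.cosh y ^ 2 - m ^ 2 * Real.sinh y ^ 2 := by
  have hm' : m ^ 2 ≤ 1 := (sq_le_one_iff_abs_le_one m).2 hm
  nlinarith [Real.cosh_sq y, sq_nonneg (Real.sinh y)]

lemma log_add_log_eq_gain (hm : |m| ≤ 1) (y : ℝ) :
    Real.log (Real.cosh y + m * Real.sinh y) + Real.log (Real.cosh (-y) + m * Real.sinh (-y)) =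
      2 * gain y m := by
  rw [← Real.log_mul (cosh_add_mul_sinh_pos hm y).ne' (cosh_add_mul_sinh_pos hm (-y)).ne', gain,
    mul_div_cancel₀ _ two_ne_zero, Real.cosh_neg, Real.sinh_neg]
  ring_nf

lemma gain_one (y : ℝ) : gain y 1 = 0 := by
  simp [gain, Real.cosh_sq]

lemma gain_zero_left (m : ℝ) : gain 0 m = 0 := by
  simp [gain]

lemma gain_nonneg (hm : |m| ≤ 1) (y : ℝ) : 0 ≤ gain y m :=
  div_nonneg (Real.log_nonneg (one_le_cosh_sq_sub hm y)) zero_le_two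

lemma gain_le_log_cosh (hm : |m| ≤ 1) (y : ℝ) : gain y m ≤ Real.log (Real.cosh y) := by
  have h := Real.log_le_log (zero_lt_one.trans_le (one_le_cosh_sq_sub hm y))
    (sub_le_self (Real.cosh y ^ 2) (by positivity : 0 ≤ m ^ 2 * Real.sinh y ^ 2))
  rw [Real.log_pow] at h
  unfold gain
  push_cast at h
  linarith

lemma gain_le_abs (hm : |m| ≤ 1) (y : ℝ) : gain y m ≤ |y| := by
  refine (gain_le_log_cosh hm y).trans ?_
  rw [Real.log_le_iff_le_exp (Real.cosh_pos y), ← Real.cosh_abs, ← Real.cosh_add_sinh |y|]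
  linarith [Real.sinh_nonneg_iff.2 (abs_nonneg y)]

lemma gain_le_half_sq (hm : |m| ≤ 1) (y : ℝ) : gain y m ≤ y ^ 2 / 2 := by
  refine (gain_le_log_cosh hm y).trans ?_
  rw [Real.log_le_iff_le_exp (Real.cosh_pos y)]
  exact Real.cosh_le_exp_half_sq y

@[fun_prop]
lemma measurable_gain : Measurable fun z : ℝ × ℝ => gain z.1 z.2 := by
  unfold gain
  fun_prop

lemma tanh_mul_sq_lt_one (hm : |m| ≤ 1) (y : ℝ) : (Real.tanh y * m) ^ 2 < 1 := by
  rw [sq_lt_one_iff_abs_lt_one, abs_mul]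
  exact mul_lt_one_of_nonneg_of_lt_one_left (abs_nonneg _) (Real.abs_tanh_lt_one y) hm

lemma gain_eq_log_cosh_add (hm : |m| ≤ 1) (y : ℝ) :
    gain y m = Real.log (Real.cosh y) + Real.log (1 - (Real.tanh y * m) ^ 2) / 2 := by
  have hcosh := (Real.cosh_pos y).ne'
  have hfactor : Real.cosh y ^ 2 - m ^ 2 * Real.sinh y ^ 2 =
      Real.cosh y ^ 2 * (1 - (Real.tanh y * m) ^ 2) := by
    rw [Real.tanh_eq_sinh_div_cosh]
    field_simp
  rw [gain, hfactor, Real.log_mul (pow_ne_zero 2 hcosh)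
    (sub_pos.2 (tanh_mul_sq_lt_one hm y)).ne', Real.log_pow]
  push_cast
  ring

end Gain

/-! ### Conditional negativity of the matrix of gains -/

section ConditionalNegativity

variable {N : ℕ}

/-- Expanded over `n` replicas of the system, the quadratic form is an average of squares. -/
lemma sum_mul_gibbs_pow_nonneg (x : Pairs N → ℝ) (u : Fin N → ℝ) (n : ℕ) :
    0 ≤ ∑ i, ∑ j, u i * u j * gibbs x i j ^ n := by
  let w : Config N → ℝ := fun σ => Real.exp (energy x σ) / ∑ τ : Config N, Real.exp (energy x τ)
  have hw : ∀ σ, 0 ≤ w σ := fun σ => div_nonneg (Real.exp_pos _).le (sum_exp_energy_pos x).le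
  have hgibbs : ∀ i j, gibbs x i j = ∑ σ, w σ * (spin σ i * spin σ j) := fun i j => by
    simp only [gibbs, Finset.sum_div, w, div_mul_eq_mul_div]
  have hreplica : ∀ i j, gibbs x i j ^ n = ∑ s : Fin n → Config N,
      (∏ a, w (s a)) * ((∏ a, spin (s a) i) * ∏ a, spin (s a) j) := fun i j => by
    rw [hgibbs, Fintype.sum_pow]
    simp only [Finset.prod_mul_distrib]
  have hsquares : ∑ i, ∑ j, u i * u j * gibbs x i j ^ n = ∑ s : Fin n → Config N,
      (∏ a, w (s a)) * (∑ i, u i * ∏ a, spin (s a) i) ^ 2 := by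
    simp_rw [hreplica, sq, Finset.sum_mul_sum, Finset.mul_sum]
    rw [Finset.sum_comm (s := (Finset.univ : Finset (Fin n → Config N)))]
    refine Finset.sum_congr rfl fun i _ => ?_
    rw [Finset.sum_comm]
    congr! 2
    ring
  rw [hsquares]
  exact Finset.sum_nonneg fun s _ =>
    mul_nonneg (Finset.prod_nonneg fun a _ => hw _) (sq_nonneg _)

lemma sum_mul_log_one_sub_tanh_mul_gibbs_sq_nonpos (x : Pairs N → ℝ) (u : Fin N → ℝ) (y : ℝ) :
    ∑ i, ∑ j, u i * u j * Real.log (1 - (Real.tanh y * gibbs x i j) ^ 2) ≤ 0 := by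
  have hlog : ∀ i j, HasSum (fun n : ℕ => u i * u j *
      (((Real.tanh y * gibbs x i j) ^ 2) ^ (n + 1) / (n + 1)))
      (u i * u j * -Real.log (1 - (Real.tanh y * gibbs x i j) ^ 2)) := fun i j => by
    refine (Real.hasSum_pow_div_log_of_abs_lt_one ?_).mul_left _
    rw [abs_of_nonneg (by positivity)]
    exact tanh_mul_sq_lt_one (abs_gibbs_le_one x i j) y
  have hsum := hasSum_sum (s := Finset.univ) fun i _ =>
    hasSum_sum (s := Finset.univ) fun j _ => hlog i j
  have hnonneg := hsum.nonneg fun n => by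
    have hterm : ∑ i, ∑ j, u i * u j * (((Real.tanh y * gibbs x i j) ^ 2) ^ (n + 1) / (n + 1)) =
        Real.tanh y ^ (2 * (n + 1)) / (n + 1) *
          ∑ i, ∑ j, u i * u j * gibbs x i j ^ (2 * (n + 1)) := by
      simp only [Finset.mul_sum, ← pow_mul, mul_pow]
      congr! 2
      ring
    rw [hterm]
    exact mul_nonneg (div_nonneg ((even_two_mul _).pow_nonneg _) (by positivity))
      (sum_mul_gibbs_pow_nonneg x u _)
  simpa only [mul_neg, Finset.sum_neg_distrib, Left.nonneg_neg_iff] using hnonneg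

lemma sum_mul_gain_nonpos (x : Pairs N → ℝ) (u : Fin N → ℝ) (hu : ∑ i, u i = 0) (y : ℝ) :
    ∑ i, ∑ j, u i * u j * gain y (gibbs x i j) ≤ 0 := by
  have hsplit : ∑ i, ∑ j, u i * u j * gain y (gibbs x i j) =
      Real.log (Real.cosh y) * ((∑ i, u i) * ∑ j, u j) +
        (∑ i, ∑ j, u i * u j * Real.log (1 - (Real.tanh y * gibbs x i j) ^ 2)) / 2 := by
    rw [Finset.sum_mul_sum]
    simp only [Finset.mul_sum, Finset.sum_div, ← Finset.sum_add_distrib]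
    refine Finset.sum_congr rfl fun i _ => Finset.sum_congr rfl fun j _ => ?_
    rw [gain_eq_log_cosh_add (abs_gibbs_le_one x i j)]
    ring
  rw [hsplit, hu]
  linarith [sum_mul_log_one_sub_tanh_mul_gibbs_sq_nonpos x u y]

end ConditionalNegativity

/-! ### Interpolation between product measures -/

section Mixture

variable {E : Type*} [MeasurableSpace E]

/-- The mixture `(1 - t) ν₀ + t ν₁` of two measures, meant for `t ∈ [0, 1]`. -/
def mixture (t : ℝ) (ν₀ ν₁ : Measure E) : Measure E :=
  (1 - t).toNNReal • ν₀ + t.toNNReal • ν₁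

instance isFiniteMeasure_mixture (t : ℝ) (ν₀ ν₁ : Measure E) [IsFiniteMeasure ν₀]
    [IsFiniteMeasure ν₁] : IsFiniteMeasure (mixture t ν₀ ν₁) := by
  unfold mixture
  infer_instance

lemma mixture_zero (ν₀ ν₁ : Measure E) : mixture 0 ν₀ ν₁ = ν₀ := by
  simp [mixture]

lemma mixture_one (ν₀ ν₁ : Measure E) : mixture 1 ν₀ ν₁ = ν₁ := by
  simp [mixture]

lemma isProbabilityMeasure_mixture {t : ℝ} (ht : t ∈ Set.Icc (0 : ℝ) 1) (ν₀ ν₁ : Measure E)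
    [IsProbabilityMeasure ν₀] [IsProbabilityMeasure ν₁] :
    IsProbabilityMeasure (mixture t ν₀ ν₁) := by
  refine ⟨?_⟩
  simp only [mixture, Measure.add_apply, Measure.smul_apply, measure_univ, ENNReal.smul_def,
    smul_eq_mul, mul_one]
  rw [← ENNReal.coe_add, ← Real.toNNReal_add (by linarith [ht.2]) ht.1]
  simp

lemma integrable_mixture {ν₀ ν₁ : Measure E} {f : E → ℝ} (h₀ : Integrable f ν₀)
    (h₁ : Integrable f ν₁) (t : ℝ) : Integrable f (mixture t ν₀ ν₁) :=
  (h₀.smul_measure_nnreal).add_measure h₁.smul_measure_nnreal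

lemma integral_mixture {t : ℝ} (ht : t ∈ Set.Icc (0 : ℝ) 1) {ν₀ ν₁ : Measure E} {f : E → ℝ}
    (h₀ : Integrable f ν₀) (h₁ : Integrable f ν₁) :
    ∫ y, f y ∂(mixture t ν₀ ν₁) = (1 - t) * ∫ y, f y ∂ν₀ + t * ∫ y, f y ∂ν₁ := by
  rw [mixture, integral_add_measure h₀.smul_measure_nnreal
    h₁.smul_measure_nnreal, integral_smul_nnreal_measure, integral_smul_nnreal_measure]
  simp only [NNReal.smul_def, smul_eq_mul, Real.coe_toNNReal _ ht.1,
    Real.coe_toNNReal _ (sub_nonneg.2 ht.2)]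

lemma mixture_real_apply {t : ℝ} (ht : t ∈ Set.Icc (0 : ℝ) 1) (ν₀ ν₁ : Measure E)
    [IsFiniteMeasure ν₀] [IsFiniteMeasure ν₁] (s : Set E) :
    (mixture t ν₀ ν₁).real s = (1 - t) * ν₀.real s + t * ν₁.real s := by
  rw [mixture, measureReal_add_apply, measureReal_nnreal_smul_apply, measureReal_nnreal_smul_apply,
    Real.coe_toNNReal _ ht.1, Real.coe_toNNReal _ (sub_nonneg.2 ht.2)]

end Mixture

section ProductMeasure

variable {ι E : Type*} [Fintype ι] [MeasurableSpace E]

/-- The probability that independent trials, with success probability `p e` for the trial `e`,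
succeed exactly on `A`. -/
def bernoulliWeight [DecidableEq ι] (p : ι → ℝ) (A : Finset ι) : ℝ :=
  ∏ e, if e ∈ A then p e else 1 - p e

variable [DecidableEq ι]

instance isProbabilityMeasure_piecewise (ν₀ ν₁ : ι → Measure E) [∀ e, IsProbabilityMeasure (ν₀ e)]
    [∀ e, IsProbabilityMeasure (ν₁ e)] (A : Finset ι) (e : ι) :
    IsProbabilityMeasure (A.piecewise ν₁ ν₀ e) := by
  by_cases h : e ∈ A <;> simp only [h, Finset.piecewise_eq_of_mem, Finset.piecewise_eq_of_notMem,
    not_false_eq_true] <;> infer_instance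

instance isProbabilityMeasure_update (ν : ι → Measure E) [∀ e, IsProbabilityMeasure (ν e)]
    (e : ι) (ν' : Measure E) [IsProbabilityMeasure ν'] (i : ι) :
    IsProbabilityMeasure (Function.update ν e ν' i) := by
  by_cases h : i = e
  · subst h
    rwa [Function.update_self]
  · rw [Function.update_of_ne h]
    infer_instance

lemma map_update_pi_prod (ν : ι → Measure E) [∀ e, IsProbabilityMeasure (ν e)] (e : ι)
    (ν' : Measure E) [IsProbabilityMeasure ν'] :
    ((Measure.pi ν).prod ν').map (fun z : (ι → E) × E => Function.update z.1 e z.2) =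
      Measure.pi (Function.update ν e ν') := by
  refine (Measure.pi_eq fun s hs => ?_).symm
  have hpre : (fun z : (ι → E) × E => Function.update z.1 e z.2) ⁻¹' Set.univ.pi s =
      (Set.univ.pi (Function.update s e Set.univ)) ×ˢ s e := by
    ext ⟨x, y⟩
    simp only [Set.mem_preimage, Set.mem_pi, Set.mem_univ, true_imp_iff, Set.mem_prod]
    grind
  rw [Measure.map_apply (by fun_prop) (MeasurableSet.univ_pi hs), hpre, Measure.prod_prod,
    Measure.pi_pi, ← Finset.mul_prod_erase _ _ (Finset.mem_univ e),
    ← Finset.mul_prod_erase Finset.univ (fun i => Function.update ν e ν' i (s i))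
      (Finset.mem_univ e), Function.update_self, Function.update_self, measure_univ, one_mul,
    mul_comm]
  congr 1
  refine Finset.prod_congr rfl fun i hi => ?_
  simp only [Function.update_of_ne (Finset.ne_of_mem_erase hi)]

section Update

variable (ν : ι → Measure E) [∀ e, IsProbabilityMeasure (ν e)] (e : ι)
  {ν' : Measure E} [IsProbabilityMeasure ν'] {F : (ι → E) → ℝ}

lemma integrable_comp_update (hF : Integrable F (Measure.pi (Function.update ν e ν'))) :
    Integrable (fun z : (ι → E) × E => F (Function.update z.1 e z.2)) ((Measure.pi ν).prod ν') := by
  rw [← map_update_pi_prod] at hF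
  exact hF.comp_measurable (by fun_prop)

lemma integral_pi_update (hF : Integrable F (Measure.pi (Function.update ν e ν'))) :
    ∫ x, F x ∂(Measure.pi (Function.update ν e ν')) =
      ∫ x, ∫ y, F (Function.update x e y) ∂ν' ∂(Measure.pi ν) := by
  rw [← integral_prod _ (integrable_comp_update ν e hF)]
  rw [← map_update_pi_prod] at hF ⊢
  exact integral_map (by fun_prop) hF.aestronglyMeasurable

end Update

section Interpolation

lemma bernoulliWeight_nonneg {p : ι → ℝ} (hp : ∀ e, p e ∈ Set.Icc (0 : ℝ) 1) (A : Finset ι) :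
    0 ≤ bernoulliWeight p A :=
  Finset.prod_nonneg fun e _ => by
    split_ifs
    exacts [(hp e).1, sub_nonneg.2 (hp e).2]

lemma bernoulliWeight_update (p : ι → ℝ) (e : ι) (a : ℝ) (A : Finset ι) :
    bernoulliWeight (Function.update p e a) A =
      (∏ i ∈ Finset.univ.erase e, if i ∈ A then p i else 1 - p i) *
        if e ∈ A then a else 1 - a := by
  rw [bernoulliWeight, ← Finset.prod_erase_mul _ _ (Finset.mem_univ e), Function.update_self]
  congr 1
  refine Finset.prod_congr rfl fun i hi => ?_
  rw [Function.update_of_ne (Finset.ne_of_mem_erase hi)]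

lemma hasDerivAt_bernoulliWeight (A : Finset ι) (t : ℝ) :
    HasDerivAt (fun s => bernoulliWeight (fun _ => s) A)
      (∑ e, (bernoulliWeight (Function.update (fun _ => t) e 1) A -
        bernoulliWeight (Function.update (fun _ => t) e 0) A)) t := by
  have hfactor : ∀ e ∈ Finset.univ, HasDerivAt (fun s : ℝ => if e ∈ A then s else 1 - s)
      (if e ∈ A then 1 else -1) t := fun e _ => by
    split_ifs
    exacts [hasDerivAt_id t, (hasDerivAt_id t).const_sub 1]
  refine (HasDerivAt.fun_finsetProd hfactor).congr_deriv (Finset.sum_congr rfl fun e _ => ?_)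
  rw [bernoulliWeight_update, bernoulliWeight_update, ← mul_sub, smul_eq_mul]
  congr 1
  split_ifs <;> simp

variable {ν₀ ν₁ : ι → Measure E} [∀ e, IsProbabilityMeasure (ν₀ e)]
  [∀ e, IsProbabilityMeasure (ν₁ e)] {F : (ι → E) → ℝ}

lemma pi_mixture {p : ι → ℝ} (hp : ∀ e, p e ∈ Set.Icc (0 : ℝ) 1) :
    Measure.pi (fun e => mixture (p e) (ν₀ e) (ν₁ e)) =
      ∑ A : Finset ι, (bernoulliWeight p A).toNNReal • Measure.pi (A.piecewise ν₁ ν₀) := by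
  refine Measure.pi_eq fun s _ => ?_
  have hfactor : ∀ A : Finset ι, (bernoulliWeight p A).toNNReal • Measure.pi (A.piecewise ν₁ ν₀)
      (Set.univ.pi s) = ∏ e, A.piecewise (fun e => (p e).toNNReal • ν₁ e (s e))
        (fun e => (1 - p e).toNNReal • ν₀ e (s e)) e := fun A => by
    rw [bernoulliWeight, Real.toNNReal_prod_of_nonneg, Measure.pi_pi, ENNReal.smul_def,
      ENNReal.ofNNReal_finsetProd, smul_eq_mul, ← Finset.prod_mul_distrib]
    · refine Finset.prod_congr rfl fun e _ => ?_
      by_cases h : e ∈ A <;> simp [h, ENNReal.smul_def]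
    · intro e _
      split_ifs
      exacts [(hp e).1, sub_nonneg.2 (hp e).2]
  simp only [Measure.finsetSum_apply, Measure.smul_apply, hfactor, Finset.prod_piecewise,
    Finset.univ_inter, mixture, Measure.add_apply]
  rw [← Finset.powerset_univ, ← Finset.prod_add]
  exact Finset.prod_congr rfl fun e _ => add_comm _ _

lemma integrable_pi_mixture {p : ι → ℝ} (hp : ∀ e, p e ∈ Set.Icc (0 : ℝ) 1)
    (hF : ∀ A : Finset ι, Integrable F (Measure.pi (A.piecewise ν₁ ν₀))) :
    Integrable F (Measure.pi fun e => mixture (p e) (ν₀ e) (ν₁ e)) := by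
  rw [pi_mixture hp]
  exact integrable_finsetSum_measure.2 fun A _ => (hF A).smul_measure_nnreal

lemma integral_pi_mixture {p : ι → ℝ} (hp : ∀ e, p e ∈ Set.Icc (0 : ℝ) 1)
    (hF : ∀ A : Finset ι, Integrable F (Measure.pi (A.piecewise ν₁ ν₀))) :
    ∫ x, F x ∂(Measure.pi fun e => mixture (p e) (ν₀ e) (ν₁ e)) =
      ∑ A : Finset ι, bernoulliWeight p A * ∫ x, F x ∂(Measure.pi (A.piecewise ν₁ ν₀)) := by
  rw [pi_mixture hp, integral_finsetSum_measure fun A _ => (hF A).smul_measure_nnreal]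
  refine Finset.sum_congr rfl fun A _ => ?_
  rw [integral_smul_nnreal_measure, NNReal.smul_def, smul_eq_mul,
    Real.coe_toNNReal _ (bernoulliWeight_nonneg hp A)]

lemma integral_pi_mixture_update {t a : ℝ} (ht : t ∈ Set.Icc (0 : ℝ) 1)
    (ha : a ∈ Set.Icc (0 : ℝ) 1)
    (hF : ∀ A : Finset ι, Integrable F (Measure.pi (A.piecewise ν₁ ν₀))) (e : ι) :
    ∫ x, ∫ y, F (Function.update x e y) ∂(mixture a (ν₀ e) (ν₁ e))
        ∂(Measure.pi fun i => mixture t (ν₀ i) (ν₁ i)) =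
      ∑ A : Finset ι, bernoulliWeight (Function.update (fun _ => t) e a) A *
        ∫ x, F x ∂(Measure.pi (A.piecewise ν₁ ν₀)) := by
  have hp : ∀ i, Function.update (fun _ => t) e a i ∈ Set.Icc (0 : ℝ) 1 := by
    intro i
    rcases eq_or_ne i e with rfl | h <;> simp [*]
  have hlaw : (fun i => mixture (Function.update (fun _ => t) e a i) (ν₀ i) (ν₁ i)) =
      Function.update (fun i => mixture t (ν₀ i) (ν₁ i)) e (mixture a (ν₀ e) (ν₁ e)) := by
    ext1 i
    rcases eq_or_ne i e with rfl | h <;> simp [*]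
  have := fun i => isProbabilityMeasure_mixture ht (ν₀ i) (ν₁ i)
  have := isProbabilityMeasure_mixture ha (ν₀ e) (ν₁ e)
  have hint := integrable_pi_mixture hp hF
  rw [← integral_pi_mixture hp hF]
  rw [hlaw] at hint ⊢
  rw [integral_pi_update _ _ hint]

/-- Russo's formula makes the derivative of `t ↦ ∫ F d(⨂ mixture t)` a sum of effects of single
coordinates. -/
lemma integral_pi_le_integral_pi_add {K : ℝ}
    (hF : ∀ A : Finset ι, Integrable F (Measure.pi (A.piecewise ν₁ ν₀)))
    (hK : ∀ t ∈ Set.Ioo (0 : ℝ) 1, -K ≤ ∑ e,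
      (∫ x, ∫ y, F (Function.update x e y) ∂ν₁ e ∂(Measure.pi fun i => mixture t (ν₀ i) (ν₁ i)) -
        ∫ x, ∫ y, F (Function.update x e y) ∂ν₀ e
          ∂(Measure.pi fun i => mixture t (ν₀ i) (ν₁ i)))) :
    ∫ x, F x ∂(Measure.pi ν₀) ≤ ∫ x, F x ∂(Measure.pi ν₁) + K := by
  let G : Finset ι → ℝ := fun A => ∫ x, F x ∂(Measure.pi (A.piecewise ν₁ ν₀))
  let φ : ℝ → ℝ := fun t => ∑ A, bernoulliWeight (fun _ => t) A * G A
  have hderiv : ∀ t, HasDerivAt φ (∑ A, (∑ e,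
      (bernoulliWeight (Function.update (fun _ => t) e 1) A -
        bernoulliWeight (Function.update (fun _ => t) e 0) A)) * G A) t := fun t =>
    HasDerivAt.fun_sum fun A _ => (hasDerivAt_bernoulliWeight A t).mul_const _
  have hmono := Convex.mul_sub_le_image_sub_of_le_deriv (convex_Icc (0 : ℝ) 1) (f := φ) (C := -K)
    (fun t _ => (hderiv t).continuousAt.continuousWithinAt)
    (fun t _ => (hderiv t).differentiableAt.differentiableWithinAt) fun t ht => ?_
  · have h₀ := integral_pi_mixture (p := fun _ => 0) (by simp) hF
    have h₁ := integral_pi_mixture (p := fun _ => 1) (by simp) hF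
    simp only [mixture_zero, mixture_one] at h₀ h₁
    rw [h₀, h₁]
    linarith [hmono 0 (by simp) 1 (by simp) zero_le_one]
  · rw [interior_Icc] at ht
    have hrusso := fun a ha e =>
      integral_pi_mixture_update (Set.Ioo_subset_Icc_self ht) (a := a) ha hF e
    have h₀ := hrusso 0 (by simp)
    have h₁ := hrusso 1 (by simp)
    simp only [mixture_zero, mixture_one] at h₀ h₁
    convert hK t ht using 1
    simp only [(hderiv t).deriv, h₀, h₁, Finset.sum_mul, sub_mul, Finset.sum_sub_distrib, G]
    rw [Finset.sum_comm]
    congr 1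
    rw [Finset.sum_comm]

end Interpolation

end ProductMeasure

/-! ### Couplings with symmetric laws -/

section SymmetricCouplings

/-- The expectation of `gain y m` for a coupling `y` of law `ν`. -/
def meanGain (ν : Measure ℝ) (m : ℝ) : ℝ := ∫ y, gain y m ∂ν

lemma integrable_gain {ν : Measure ℝ} (hν : Integrable id ν) {m : ℝ} (hm : |m| ≤ 1) :
    Integrable (fun y => gain y m) ν := by
  refine hν.abs.mono' (by fun_prop) (Eventually.of_forall fun y => ?_)
  rw [Real.norm_of_nonneg (gain_nonneg hm y)]
  exact gain_le_abs hm y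

@[fun_prop]
lemma measurable_meanGain (ν : Measure ℝ) [SFinite ν] : Measurable (meanGain ν) :=
  (StronglyMeasurable.integral_prod_right (f := fun m y => gain y m)
    (by fun_prop : Measurable fun z : ℝ × ℝ => gain z.2 z.1).stronglyMeasurable).measurable

lemma meanGain_nonneg (ν : Measure ℝ) {m : ℝ} (hm : |m| ≤ 1) : 0 ≤ meanGain ν m :=
  integral_nonneg fun y => gain_nonneg hm y

lemma meanGain_le {ν : Measure ℝ} (hν : Integrable id ν) {m : ℝ} (hm : |m| ≤ 1) :
    meanGain ν m ≤ ∫ y, |y| ∂ν :=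
  integral_mono (integrable_gain hν hm) hν.abs fun y => gain_le_abs hm y

lemma meanGain_dirac_zero (m : ℝ) : meanGain (Measure.dirac 0) m = 0 := by
  rw [meanGain, integral_dirac, gain_zero_left]

lemma meanGain_mixture {t : ℝ} (ht : t ∈ Set.Icc (0 : ℝ) 1) {ν₀ ν₁ : Measure ℝ}
    (h₀ : Integrable id ν₀) (h₁ : Integrable id ν₁) {m : ℝ} (hm : |m| ≤ 1) :
    meanGain (mixture t ν₀ ν₁) m = (1 - t) * meanGain ν₀ m + t * meanGain ν₁ m :=
  integral_mixture ht (integrable_gain h₀ hm) (integrable_gain h₁ hm)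

variable {N : ℕ}

/-- The Gibbs correlation of the two spins of the pair `e` when their coupling is switched off. -/
def cavityGibbs (x : Pairs N → ℝ) (e : Pairs N) : ℝ :=
  gibbs (Function.update x e 0) e.1.1 e.1.2

@[fun_prop]
lemma measurable_cavityGibbs (e : Pairs N) : Measurable fun x => cavityGibbs x e := by
  unfold cavityGibbs
  exact (continuous_gibbs _ _).measurable.comp measurable_update_left

lemma abs_cavityGibbs_le_one (x : Pairs N → ℝ) (e : Pairs N) : |cavityGibbs x e| ≤ 1 :=
  abs_gibbs_le_one _ _ _

lemma integrable_logZ_update {ν : Measure ℝ} [IsFiniteMeasure ν] (hν : Integrable id ν)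
    (x : Pairs N → ℝ) (e : Pairs N) :
    Integrable (fun y => logZ (Function.update x e y)) ν := by
  have hbound : Integrable (fun y : ℝ => |y| + |logZ (Function.update x e 0)|) ν :=
    hν.abs.add (integrable_const _)
  refine hbound.mono' (by fun_prop) (Eventually.of_forall fun y => ?_)
  have h := abs_logZ_sub_le (Function.update x e y) (Function.update x e 0)
  have hsum : ∑ p, |Function.update x e y p - Function.update x e 0 p| = |y| := by
    rw [Finset.sum_eq_single e (fun p _ hp => by simp [hp]) (by simp)]
    simp
  rw [Real.norm_eq_abs]
  linarith [abs_sub_abs_le_abs_sub (logZ (Function.update x e y)) (logZ (Function.update x e 0))]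

lemma logZ_update_add_logZ_update_neg (x : Pairs N → ℝ) (e : Pairs N) (y : ℝ) :
    logZ (Function.update x e y) + logZ (Function.update x e (-y)) =
      2 * (logZ (Function.update x e 0) + gain y (cavityGibbs x e)) := by
  rw [logZ_update x e y, logZ_update x e (-y)]
  have hgain := log_add_log_eq_gain (abs_cavityGibbs_le_one x e) y
  unfold cavityGibbs at hgain ⊢
  linarith

lemma integral_logZ_update {ν : Measure ℝ} [IsProbabilityMeasure ν] [ν.IsNegInvariant]
    (hν : Integrable id ν) (x : Pairs N → ℝ) (e : Pairs N) :
    ∫ y, logZ (Function.update x e y) ∂ν =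
      logZ (Function.update x e 0) + meanGain ν (cavityGibbs x e) := by
  have hint := integrable_logZ_update hν x e
  have hneg := integral_neg_eq_self (fun y => logZ (Function.update x e y)) ν
  have hsum : ∫ y, (logZ (Function.update x e y) + logZ (Function.update x e (-y))) ∂ν =
      2 * (logZ (Function.update x e 0) + meanGain ν (cavityGibbs x e)) := by
    simp only [logZ_update_add_logZ_update_neg]
    rw [integral_const_mul, integral_add (integrable_const _)
      (integrable_gain hν (abs_cavityGibbs_le_one x e))]
    simp [meanGain]
  rw [integral_add hint hint.comp_neg, hneg] at hsum
  linarith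

section Pi

variable {ν : Pairs N → Measure ℝ} [∀ p, IsProbabilityMeasure (ν p)]

lemma integrable_sum_abs (hν : ∀ p, Integrable id (ν p)) :
    Integrable (fun x : Pairs N → ℝ => ∑ p, |x p|) (Measure.pi ν) :=
  integrable_finsetSum _ fun p _ =>
    integrable_comp_eval (μ := ν) (f := fun y : ℝ => |y|) (i := p) (hν p).abs

lemma integrable_logZ (hν : ∀ p, Integrable id (ν p)) :
    Integrable (logZ (N := N)) (Measure.pi ν) := by
  refine ((integrable_sum_abs hν).add (integrable_const |logZ (0 : Pairs N → ℝ)|)).mono'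
    (by fun_prop) (Eventually.of_forall fun x => ?_)
  have h := abs_logZ_sub_le x 0
  simp only [Pi.zero_apply, sub_zero] at h
  rw [Real.norm_eq_abs, Pi.add_apply]
  linarith [abs_sub_abs_le_abs_sub (logZ x) (logZ (0 : Pairs N → ℝ))]

lemma integral_logZ_le (hν : ∀ p, Integrable id (ν p)) :
    ∫ x, logZ x ∂(Measure.pi ν) ≤ N * Real.log 2 + ∑ p, ∫ y, |y| ∂(ν p) := by
  have hcoord : ∀ p, ∫ x, |x p| ∂(Measure.pi ν) = ∫ y, |y| ∂(ν p) := fun p =>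
    integral_comp_eval (μ := ν) (f := fun y : ℝ => |y|) (i := p) (hν p).abs.aestronglyMeasurable
  calc ∫ x, logZ x ∂(Measure.pi ν)
      ≤ ∫ x, (N * Real.log 2 + ∑ p, |x p|) ∂(Measure.pi ν) := by
        refine integral_mono (integrable_logZ hν)
          ((integrable_const _).add (integrable_sum_abs hν)) fun x => ?_
        simpa [logZ_zero] using logZ_le_add_sum_abs_sub x 0
    _ = N * Real.log 2 + ∑ p, ∫ y, |y| ∂(ν p) := by
        rw [integral_add (integrable_const _) (integrable_sum_abs hν), integral_finsetSum _
          fun p _ => integrable_comp_eval (μ := ν) (f := fun y : ℝ => |y|) (i := p) (hν p).abs]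
        simp [hcoord]

end Pi

lemma integrable_meanGain_cavityGibbs {ν : Measure ℝ} [SFinite ν] (hν : Integrable id ν)
    (e : Pairs N) (κ : Measure (Pairs N → ℝ)) [IsFiniteMeasure κ] :
    Integrable (fun x => meanGain ν (cavityGibbs x e)) κ := by
  refine (integrable_const (∫ y, |y| ∂ν)).mono'
    ((measurable_meanGain ν).comp (measurable_cavityGibbs e)).aestronglyMeasurable
    (Eventually.of_forall fun x => ?_)
  have hm := abs_cavityGibbs_le_one x e
  rw [Real.norm_of_nonneg (meanGain_nonneg ν hm)]
  exact meanGain_le hν hm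

section Comparison

instance isNegInvariant_dirac_zero : (Measure.dirac (0 : ℝ)).IsNegInvariant :=
  ⟨(Measure.map_dirac' measurable_neg 0).trans (by rw [neg_zero])⟩

instance isNegInvariant_mixture (t : ℝ) (ν₀ ν₁ : Measure ℝ) [ν₀.IsNegInvariant]
    [ν₁.IsNegInvariant] : (mixture t ν₀ ν₁).IsNegInvariant :=
  ⟨by rw [Measure.neg_def, mixture, Measure.map_add _ _ measurable_neg, Measure.map_smul,
    Measure.map_smul, Measure.map_neg_eq_self, Measure.map_neg_eq_self]⟩

lemma integrable_id_dirac_zero : Integrable id (Measure.dirac (0 : ℝ)) :=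
  integrable_dirac (by simp)

variable {ν₀ ν₁ : Pairs N → Measure ℝ} [∀ e, IsProbabilityMeasure (ν₀ e)]
  [∀ e, IsProbabilityMeasure (ν₁ e)]

lemma integrable_logZ_update_zero (h₀ : ∀ e, Integrable id (ν₀ e)) (e : Pairs N) :
    Integrable (fun x => logZ (Function.update x e 0)) (Measure.pi ν₀) := by
  have hlaw : ∀ p, Integrable id (Function.update ν₀ e (Measure.dirac 0) p) := fun p => by
    rcases eq_or_ne p e with rfl | hp
    · rw [Function.update_self]
      exact integrable_id_dirac_zero
    · rw [Function.update_of_ne hp]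
      exact h₀ p
  simpa using (integrable_comp_update ν₀ e (integrable_logZ hlaw)).integral_prod_left

variable [∀ e, (ν₀ e).IsNegInvariant] [∀ e, (ν₁ e).IsNegInvariant]

lemma integral_logZ_pi_le_add {K : ℝ} (h₀ : ∀ e, Integrable id (ν₀ e))
    (h₁ : ∀ e, Integrable id (ν₁ e))
    (hK : ∀ t ∈ Set.Ioo (0 : ℝ) 1, -K ≤ ∑ e,
      ∫ x, (meanGain (ν₁ e) (cavityGibbs x e) - meanGain (ν₀ e) (cavityGibbs x e))
        ∂(Measure.pi fun i => mixture t (ν₀ i) (ν₁ i))) :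
    ∫ x, logZ x ∂(Measure.pi ν₀) ≤ ∫ x, logZ x ∂(Measure.pi ν₁) + K := by
  refine integral_pi_le_integral_pi_add (fun A => integrable_logZ fun e => ?_) fun t ht => ?_
  · by_cases he : e ∈ A
    · rw [Finset.piecewise_eq_of_mem _ _ _ he]
      exact h₁ e
    · rw [Finset.piecewise_eq_of_notMem _ _ _ he]
      exact h₀ e
  · have := fun i => isProbabilityMeasure_mixture (Set.Ioo_subset_Icc_self ht) (ν₀ i) (ν₁ i)
    refine (hK t ht).trans_eq (Finset.sum_congr rfl fun e _ => ?_)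
    have hZ := integrable_logZ_update_zero (fun i => integrable_mixture (h₀ i) (h₁ i) t) e
    simp only [integral_logZ_update (h₀ e), integral_logZ_update (h₁ e)]
    rw [integral_add hZ (integrable_meanGain_cavityGibbs (h₁ e) e _),
      integral_add hZ (integrable_meanGain_cavityGibbs (h₀ e) e _), add_sub_add_left_eq_sub,
      integral_sub (integrable_meanGain_cavityGibbs (h₁ e) e _)
        (integrable_meanGain_cavityGibbs (h₀ e) e _)]

lemma integral_logZ_pi_le_add_card_mul {c : ℝ} (h₀ : ∀ e, Integrable id (ν₀ e))
    (h₁ : ∀ e, Integrable id (ν₁ e))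
    (hc : ∀ e, ∀ m : ℝ, |m| ≤ 1 → meanGain (ν₀ e) m ≤ meanGain (ν₁ e) m + c) :
    ∫ x, logZ x ∂(Measure.pi ν₀) ≤
      ∫ x, logZ x ∂(Measure.pi ν₁) + Fintype.card (Pairs N) * c := by
  refine integral_logZ_pi_le_add h₀ h₁ fun t ht => ?_
  have := fun i => isProbabilityMeasure_mixture (Set.Ioo_subset_Icc_self ht) (ν₀ i) (ν₁ i)
  have hcoord : ∀ e, -c ≤ ∫ x, (meanGain (ν₁ e) (cavityGibbs x e) -
      meanGain (ν₀ e) (cavityGibbs x e)) ∂(Measure.pi fun i => mixture t (ν₀ i) (ν₁ i)) := by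
    intro e
    have h := integral_mono (integrable_const (-c))
      ((integrable_meanGain_cavityGibbs (h₁ e) e _).sub
        (integrable_meanGain_cavityGibbs (h₀ e) e (Measure.pi fun i => mixture t (ν₀ i) (ν₁ i))))
      fun x => by
        have := hc e _ (abs_cavityGibbs_le_one x e)
        rw [Pi.sub_apply]
        linarith
    simpa using h
  calc -(Fintype.card (Pairs N) * c) = ∑ _e : Pairs N, -c := by simp
    _ ≤ _ := Finset.sum_le_sum fun e _ => hcoord e

end Comparison

end SymmetricCouplings

/-! ### Dilution -/

section Dilution

/-- The law of a coupling that is present with probability `p` and then has law `μ`. -/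
abbrev dilute (p : ℝ) (μ : Measure ℝ) : Measure ℝ := mixture p (Measure.dirac 0) μ

variable {N : ℕ} {μ : Measure ℝ}

lemma integrable_id_dilute (hμ : Integrable id μ) (p : ℝ) : Integrable id (dilute p μ) :=
  integrable_mixture integrable_id_dirac_zero hμ p

lemma meanGain_dilute {p : ℝ} (hp : p ∈ Set.Icc (0 : ℝ) 1) (hμ : Integrable id μ) {m : ℝ}
    (hm : |m| ≤ 1) : meanGain (dilute p μ) m = p * meanGain μ m := by
  rw [meanGain_mixture hp integrable_id_dirac_zero hμ hm, meanGain_dirac_zero, mul_zero, zero_add]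

/-- The cavity and the full correlation differ only when the coupling is present. -/
lemma abs_meanGain_cavityGibbs_sub_le (hμ : Integrable id μ) (x : Pairs N → ℝ) (e : Pairs N) :
    |meanGain μ (cavityGibbs x e) - meanGain μ (gibbs x e.1.1 e.1.2)| ≤
      (∫ y, |y| ∂μ) * Set.indicator {0}ᶜ 1 (x e) := by
  by_cases hx : x e = 0
  · have hcavity : cavityGibbs x e = gibbs x e.1.1 e.1.2 := by
      rw [cavityGibbs, ← hx, Function.update_eq_self]
    simp [hx, hcavity]
  · have hbound : ∀ m : ℝ, |m| ≤ 1 → meanGain μ m ∈ Set.Icc 0 (∫ y, |y| ∂μ) := fun m hm =>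
      ⟨meanGain_nonneg μ hm, meanGain_le hμ hm⟩
    simpa [hx] using abs_sub_le_of_le_of_le (hbound _ (abs_cavityGibbs_le_one x e)).1
      (hbound _ (abs_cavityGibbs_le_one x e)).2 (hbound _ (abs_gibbs_le_one x e.1.1 e.1.2)).1
      (hbound _ (abs_gibbs_le_one x e.1.1 e.1.2)).2

lemma abs_integral_meanGain_cavityGibbs_sub_le (hμ : Integrable id μ) (ν : Pairs N → Measure ℝ)
    [∀ e, IsProbabilityMeasure (ν e)] (e : Pairs N) :
    |∫ x, (meanGain μ (cavityGibbs x e) - meanGain μ (gibbs x e.1.1 e.1.2)) ∂(Measure.pi ν)| ≤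
      (∫ y, |y| ∂μ) * (ν e).real {0}ᶜ := by
  have hmeas : MeasurableSet ({0}ᶜ : Set ℝ) := (measurableSet_singleton 0).compl
  have hind : Integrable (Set.indicator {0}ᶜ (1 : ℝ → ℝ)) (ν e) :=
    (integrable_const (1 : ℝ)).indicator hmeas
  calc |∫ x, (meanGain μ (cavityGibbs x e) - meanGain μ (gibbs x e.1.1 e.1.2)) ∂(Measure.pi ν)|
      ≤ ∫ x : Pairs N → ℝ, (∫ y, |y| ∂μ) * Set.indicator {0}ᶜ (1 : ℝ → ℝ) (x e)
          ∂(Measure.pi ν) := by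
        rw [← Real.norm_eq_abs]
        exact norm_integral_le_of_norm_le ((integrable_comp_eval hind).const_mul _)
          (Eventually.of_forall fun x => abs_meanGain_cavityGibbs_sub_le hμ x e)
    _ = (∫ y, |y| ∂μ) * (ν e).real {0}ᶜ := by
        rw [integral_const_mul, integral_comp_eval hind.aestronglyMeasurable,
          integral_indicator_one hmeas]

variable [IsProbabilityMeasure μ]

lemma dilute_real_compl_zero_le {p : ℝ} (hp : p ∈ Set.Icc (0 : ℝ) 1) :
    (dilute p μ).real {0}ᶜ ≤ p := by
  rw [mixture_real_apply hp]
  simpa [measureReal_def] using mul_le_of_le_one_right hp.1 (measureReal_le_one (μ := μ))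

lemma integrable_meanGain_gibbs (hμ : Integrable id μ) (i j : Fin N)
    (ρ : Measure (Pairs N → ℝ)) [IsFiniteMeasure ρ] :
    Integrable (fun x => meanGain μ (gibbs x i j)) ρ := by
  refine (integrable_const (∫ y, |y| ∂μ)).mono'
    ((measurable_meanGain μ).comp (continuous_gibbs i j).measurable).aestronglyMeasurable
    (Eventually.of_forall fun x => ?_)
  have hm := abs_gibbs_le_one x i j
  rw [Real.norm_of_nonneg (meanGain_nonneg μ hm)]
  exact meanGain_le hμ hm

lemma sum_mul_integral_meanGain_gibbs_nonneg (hμ : Integrable id μ) {a : Pairs N → ℝ}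
    (ha : ∀ x y, 0 ≤ ∑ e, a e * gain y (gibbs x e.1.1 e.1.2)) (ρ : Measure (Pairs N → ℝ))
    [IsFiniteMeasure ρ] :
    0 ≤ ∑ e, a e * ∫ x, meanGain μ (gibbs x e.1.1 e.1.2) ∂ρ := by
  have hpointwise : ∀ x, 0 ≤ ∑ e, a e * meanGain μ (gibbs x e.1.1 e.1.2) := fun x => by
    have h : 0 ≤ ∫ y, ∑ e, a e * gain y (gibbs x e.1.1 e.1.2) ∂μ := integral_nonneg (ha x)
    rw [integral_finsetSum _ fun e _ =>
      (integrable_gain hμ (abs_gibbs_le_one x e.1.1 e.1.2)).const_mul _] at h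
    simpa only [meanGain, integral_const_mul] using h
  have h : 0 ≤ ∫ x, ∑ e, a e * meanGain μ (gibbs x e.1.1 e.1.2) ∂ρ := integral_nonneg hpointwise
  rw [integral_finsetSum _ fun e _ => (integrable_meanGain_gibbs hμ _ _ ρ).const_mul _] at h
  simpa only [integral_const_mul] using h

lemma abs_sub_mul_add_le_sq_add_sq {q r t : ℝ} (hq : 0 ≤ q) (hr : 0 ≤ r)
    (ht : t ∈ Set.Icc (0 : ℝ) 1) : |r - q| * ((1 - t) * q + t * r) ≤ r ^ 2 + q ^ 2 := by
  have hmax : ∀ s ∈ Set.Icc (0 : ℝ) 1, (1 - s) * q + s * r ≤ max q r := fun s hs => by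
    nlinarith [mul_le_mul_of_nonneg_left (le_max_left q r) (sub_nonneg.2 hs.2),
      mul_le_mul_of_nonneg_left (le_max_right q r) hs.1]
  have hsub : |r - q| ≤ max q r := abs_sub_le_of_nonneg_of_le hr (le_max_right _ _) hq
    (le_max_left _ _)
  have hconv : 0 ≤ (1 - t) * q + t * r :=
    add_nonneg (mul_nonneg (sub_nonneg.2 ht.2) hq) (mul_nonneg ht.1 hr)
  refine (mul_le_mul hsub (hmax t ht) hconv (hq.trans (le_max_left _ _))).trans ?_
  rcases max_cases q r with ⟨h, -⟩ | ⟨h, -⟩ <;> rw [h] <;> nlinarith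

lemma mul_integral_meanGain_gibbs_sub_le (hμ : Integrable id μ) (ν : Pairs N → Measure ℝ)
    [∀ e, IsProbabilityMeasure (ν e)] (e : Pairs N) {q r : ℝ} (hq : q ∈ Set.Icc (0 : ℝ) 1)
    (hr : r ∈ Set.Icc (0 : ℝ) 1) :
    (r - q) * ∫ x, meanGain μ (gibbs x e.1.1 e.1.2) ∂(Measure.pi ν) -
        (∫ y, |y| ∂μ) * (|r - q| * (ν e).real {0}ᶜ) ≤
      ∫ x, (meanGain (dilute r μ) (cavityGibbs x e) - meanGain (dilute q μ) (cavityGibbs x e))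
        ∂(Measure.pi ν) := by
  have herror := mul_le_mul_of_nonneg_left (abs_integral_meanGain_cavityGibbs_sub_le hμ ν e)
    (abs_nonneg (r - q))
  rw [← abs_mul, integral_sub (integrable_meanGain_cavityGibbs hμ e _)
    (integrable_meanGain_gibbs hμ _ _ _)] at herror
  simp only [meanGain_dilute hr hμ (abs_cavityGibbs_le_one _ e),
    meanGain_dilute hq hμ (abs_cavityGibbs_le_one _ e), ← sub_mul]
  rw [integral_const_mul]
  linarith [neg_abs_le ((r - q) * (∫ x, meanGain μ (cavityGibbs x e) ∂(Measure.pi ν) -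
    ∫ x, meanGain μ (gibbs x e.1.1 e.1.2) ∂(Measure.pi ν)))]

/-- The interpolation of Guerra and Toninelli: moving the density from `q` to `r` raises the mean
of `logZ`, except for the cost of hitting a pair that is already coupled. -/
lemma integral_logZ_dilute_le_add [μ.IsNegInvariant] (hμ : Integrable id μ) {q r : Pairs N → ℝ}
    (hq : ∀ e, q e ∈ Set.Icc (0 : ℝ) 1) (hr : ∀ e, r e ∈ Set.Icc (0 : ℝ) 1)
    (hgain : ∀ x y, 0 ≤ ∑ e, (r e - q e) * gain y (gibbs x e.1.1 e.1.2)) :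
    ∫ x, logZ x ∂(Measure.pi fun e => dilute (q e) μ) ≤
      ∫ x, logZ x ∂(Measure.pi fun e => dilute (r e) μ) +
        (∫ y, |y| ∂μ) * ∑ e, (r e ^ 2 + q e ^ 2) := by
  have := fun e => isProbabilityMeasure_mixture (hq e) (Measure.dirac 0) μ
  have := fun e => isProbabilityMeasure_mixture (hr e) (Measure.dirac 0) μ
  refine integral_logZ_pi_le_add (fun e => integrable_id_dilute hμ _)
    (fun e => integrable_id_dilute hμ _) fun t ht => ?_
  replace ht := Set.Ioo_subset_Icc_self ht
  have := fun e => isProbabilityMeasure_mixture ht (dilute (q e) μ) (dilute (r e) μ)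
  let ν : Pairs N → Measure ℝ := fun e => mixture t (dilute (q e) μ) (dilute (r e) μ)
  have hcost : ∀ e, |r e - q e| * (ν e).real {0}ᶜ ≤ r e ^ 2 + q e ^ 2 := fun e => by
    refine le_trans (mul_le_mul_of_nonneg_left ?_ (abs_nonneg _))
      (abs_sub_mul_add_le_sq_add_sq (hq e).1 (hr e).1 ht)
    rw [mixture_real_apply ht]
    exact add_le_add
      (mul_le_mul_of_nonneg_left (dilute_real_compl_zero_le (hq e)) (sub_nonneg.2 ht.2))
      (mul_le_mul_of_nonneg_left (dilute_real_compl_zero_le (hr e)) ht.1)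
  have hκ : 0 ≤ ∫ y, |y| ∂μ := integral_nonneg fun _ => abs_nonneg _
  calc -((∫ y, |y| ∂μ) * ∑ e, (r e ^ 2 + q e ^ 2))
      ≤ ∑ e, ((r e - q e) * ∫ x, meanGain μ (gibbs x e.1.1 e.1.2) ∂(Measure.pi ν) -
          (∫ y, |y| ∂μ) * (|r e - q e| * (ν e).real {0}ᶜ)) := by
        rw [Finset.sum_sub_distrib, ← Finset.mul_sum]
        linarith [sum_mul_integral_meanGain_gibbs_nonneg hμ hgain (Measure.pi ν),
          mul_le_mul_of_nonneg_left (Finset.sum_le_sum fun e (_ : e ∈ Finset.univ) => hcost e) hκ]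
    _ ≤ _ := Finset.sum_le_sum fun e _ => mul_integral_meanGain_gibbs_sub_le hμ ν e (hq e) (hr e)

end Dilution

/-! ### Splitting the system into two blocks -/

section Blocks

/-- The map on pairs of sites induced by an embedding of the sites. -/
def mapPair {k N : ℕ} (f : Fin k ↪o Fin N) : Pairs k ↪ Pairs N where
  toFun p := ⟨(f p.1.1, f p.1.2), f.lt_iff_lt.2 p.2⟩
  inj' p p' h := by
    simp only [Subtype.mk.injEq, Prod.mk.injEq, f.injective.eq_iff] at h
    exact Subtype.ext (Prod.ext h.1 h.2)

/-- The inclusion of the pairs of the first block of `Fin (m + n)`. -/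
abbrev leftPair {m : ℕ} (n : ℕ) : Pairs m ↪ Pairs (m + n) := mapPair (Fin.castAddOrderEmb n)

/-- The inclusion of the pairs of the second block of `Fin (m + n)`. -/
abbrev rightPair (m : ℕ) {n : ℕ} : Pairs n ↪ Pairs (m + n) := mapPair (Fin.natAddOrderEmb m)

variable {m n : ℕ}

lemma sum_pairs_add (f : Pairs (m + n) → ℝ)
    (hf : ∀ p : Pairs (m + n), (p.1.1 : ℕ) < m → m ≤ (p.1.2 : ℕ) → f p = 0) :
    ∑ p, f p = ∑ p : Pairs m, f (leftPair n p) + ∑ p : Pairs n, f (rightPair m p) := by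
  have hinj : Function.Injective (Sum.elim (leftPair n (m := m)) (rightPair m (n := n))) := by
    refine (leftPair n).injective.sumElim (rightPair m).injective fun p p' h => ?_
    have h' := congrArg (fun q : Pairs (m + n) => (q.1.1 : ℕ)) h
    simp [mapPair] at h'
    omega
  refine ((Fintype.sum_of_injective _ hinj _ f ?_ fun _ => rfl).symm).trans
    (Fintype.sum_sum_type _)
  rintro ⟨⟨i, j⟩, hij⟩ hp
  induction i using Fin.addCases with
  | left i =>
    induction j using Fin.addCases with
    | left j => exact absurd ⟨Sum.inl ⟨(i, j), hij⟩, rfl⟩ hp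
    | right j => exact hf _ (by simp) (by simp)
  | right i =>
    induction j using Fin.addCases with
    | left j => simp [Fin.lt_def] at hij; omega
    | right j => exact absurd ⟨Sum.inr ⟨(i, j), by simpa using hij⟩, rfl⟩ hp

lemma logZ_eq_add (x : Pairs (m + n) → ℝ)
    (hx : ∀ p : Pairs (m + n), (p.1.1 : ℕ) < m → m ≤ (p.1.2 : ℕ) → x p = 0) :
    logZ x = logZ (x ∘ leftPair n) + logZ (x ∘ rightPair m) := by
  unfold logZ
  rw [← Real.log_mul (sum_exp_energy_pos _).ne' (sum_exp_energy_pos _).ne', Finset.sum_mul_sum,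
    ← Fintype.sum_prod_type' (f := fun σ τ => Real.exp (energy (x ∘ leftPair n) σ) *
      Real.exp (energy (x ∘ rightPair m) τ)), ← Equiv.sum_comp (Fin.appendEquiv m n)]
  congr! 2 with στ
  rw [← Real.exp_add, energy,
    sum_pairs_add _ fun p hp₁ hp₂ => by rw [hx p hp₁ hp₂, zero_mul]]
  simp [energy, mapPair, spin, Fin.appendEquiv]

lemma measurePreserving_comp_injective {ι κ E : Type*} [Fintype ι] [Fintype κ] [MeasurableSpace E]
    (ν : ι → Measure E) [∀ i, IsProbabilityMeasure (ν i)] {f : κ → ι}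
    (hf : Function.Injective f) :
    MeasurePreserving (fun x : ι → E => x ∘ f) (Measure.pi ν) (Measure.pi fun k => ν (f k)) := by
  have hindep := (iIndepFun_pi (μ := ν) (X := fun _ y => y) fun _ => aemeasurable_id').precomp hf
  refine ⟨by fun_prop, ((iIndepFun_iff_map_fun_eq_pi_map
    fun k => (measurable_pi_apply (f k)).aemeasurable).1 hindep).trans ?_⟩
  congr 1
  ext1 k
  exact (measurePreserving_eval ν (f k)).map_eq

lemma integral_logZ_eq_add (ν : Pairs (m + n) → Measure ℝ) [∀ p, IsProbabilityMeasure (ν p)]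
    (hν : ∀ p, Integrable id (ν p)) (hcross : ∀ p : Pairs (m + n), (p.1.1 : ℕ) < m →
      m ≤ (p.1.2 : ℕ) → ν p = Measure.dirac 0) :
    ∫ x, logZ x ∂(Measure.pi ν) = ∫ x, logZ x ∂(Measure.pi fun p => ν (leftPair n p)) +
      ∫ x, logZ x ∂(Measure.pi fun p => ν (rightPair m p)) := by
  have hzero : ∀ᵐ x ∂(Measure.pi ν), ∀ p : Pairs (m + n),
      (p.1.1 : ℕ) < m → m ≤ (p.1.2 : ℕ) → x p = 0 := by
    simp only [ae_all_iff]
    intro p hp₁ hp₂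
    have h : ∀ᵐ y ∂(ν p), y = 0 := by simp [hcross p hp₁ hp₂, ae_dirac_eq]
    exact (measurePreserving_eval ν p).quasiMeasurePreserving.ae h
  have hleft := measurePreserving_comp_injective ν (leftPair n (m := m)).injective
  have hright := measurePreserving_comp_injective ν (rightPair m (n := n)).injective
  have hint₁ : Integrable (fun x => logZ (x ∘ leftPair n)) (Measure.pi ν) :=
    hleft.integrable_comp_of_integrable (integrable_logZ fun p => hν _)
  have hint₂ : Integrable (fun x => logZ (x ∘ rightPair m)) (Measure.pi ν) :=
    hright.integrable_comp_of_integrable (integrable_logZ fun p => hν _)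
  rw [integral_congr_ae (hzero.mono logZ_eq_add), integral_add hint₁ hint₂, ← hleft.map_eq,
    ← hright.map_eq, integral_map hleft.aemeasurable (by fun_prop),
    integral_map hright.aemeasurable (by fun_prop)]

end Blocks

/-! ### The diluted model -/

section DilutedModel

/-- The probability that a pair of `N` sites is coupled when every site has about `c` neighbours:
`c / N`, capped at `1`. -/
def density (c : ℝ) (N : ℕ) : ℝ := min c N / N

lemma density_of_le {c : ℝ} {N : ℕ} (h : c ≤ N) : density c N = c / N := by
  rw [density, min_eq_left h]

lemma density_mem_Icc {c : ℝ} (hc : 0 ≤ c) (N : ℕ) : density c N ∈ Set.Icc (0 : ℝ) 1 :=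
  ⟨div_nonneg (le_min hc N.cast_nonneg) N.cast_nonneg,
    div_le_one_of_le₀ (min_le_right _ _) N.cast_nonneg⟩

lemma natCast_mul_density_le {c : ℝ} (hc : 0 ≤ c) (N : ℕ) : N * density c N ≤ c := by
  rcases N.eq_zero_or_pos with rfl | hN
  · simpa using hc
  · rw [density, mul_div_cancel₀ _ (Nat.cast_ne_zero.2 hN.ne')]
    exact min_le_left _ _

lemma card_pairs_le (N : ℕ) : (Fintype.card (Pairs N) : ℝ) ≤ (N : ℝ) ^ 2 := by
  have h := Fintype.card_subtype_le fun p : Fin N × Fin N => p.1 < p.2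
  rw [Fintype.card_prod, Fintype.card_fin, ← sq] at h
  exact_mod_cast h

lemma card_pairs_mul_density_sq_le {c : ℝ} (hc : 0 ≤ c) (N : ℕ) :
    Fintype.card (Pairs N) * density c N ^ 2 ≤ c ^ 2 :=
  calc Fintype.card (Pairs N) * density c N ^ 2 ≤ (N : ℝ) ^ 2 * density c N ^ 2 := by
        gcongr
        exact card_pairs_le N
    _ = (N * density c N) ^ 2 := by ring
    _ ≤ c ^ 2 := pow_le_pow_left₀ (mul_nonneg N.cast_nonneg (density_mem_Icc hc N).1)
        (natCast_mul_density_le hc N) 2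

/-- The mean of `logZ` when each pair independently carries a coupling of law `μ` with
probability `density c N`. -/
def dilutedMean (μ : Measure ℝ) (c : ℝ) (N : ℕ) : ℝ :=
  ∫ x, logZ x ∂(Measure.pi fun _ : Pairs N => dilute (density c N) μ)

lemma dilutedMean_zero (μ : Measure ℝ) [IsProbabilityMeasure μ] {c : ℝ} (hc : 0 ≤ c) :
    dilutedMean μ c 0 = 0 := by
  have := isProbabilityMeasure_mixture (density_mem_Icc hc 0) (Measure.dirac 0) μ
  have hlogZ : ∀ x : Pairs 0 → ℝ, logZ x = 0 := fun x => by
    rw [Subsingleton.elim x 0, logZ_zero, Nat.cast_zero, zero_mul]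
  simp [dilutedMean, hlogZ]

lemma dilutedMean_le {μ : Measure ℝ} [IsProbabilityMeasure μ] (hμ : Integrable id μ) {c : ℝ}
    (hc : 0 ≤ c) (N : ℕ) : dilutedMean μ c N ≤ N * (Real.log 2 + c * ∫ y, |y| ∂μ) := by
  have hp := density_mem_Icc hc N
  have := isProbabilityMeasure_mixture hp (Measure.dirac 0) μ
  have habs : ∫ y, |y| ∂(dilute (density c N) μ) = density c N * ∫ y, |y| ∂μ :=
    (integral_mixture (f := fun y : ℝ => |y|) hp integrable_id_dirac_zero.abs hμ.abs).trans
      (by simp)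
  have hκ : 0 ≤ ∫ y, |y| ∂μ := integral_nonneg fun _ => abs_nonneg _
  calc dilutedMean μ c N
      ≤ N * Real.log 2 + ∑ _p : Pairs N, ∫ y, |y| ∂(dilute (density c N) μ) :=
        integral_logZ_le fun _ => integrable_id_dilute hμ _
    _ = N * Real.log 2 + Fintype.card (Pairs N) * (density c N * ∫ y, |y| ∂μ) := by
        rw [habs, Finset.sum_const, Finset.card_univ, nsmul_eq_mul]
    _ ≤ N * Real.log 2 + (N : ℝ) ^ 2 * (density c N * ∫ y, |y| ∂μ) := by
        gcongr
        exacts [mul_nonneg hp.1 hκ, card_pairs_le N]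
    _ = N * (Real.log 2 + N * density c N * ∫ y, |y| ∂μ) := by ring
    _ ≤ N * (Real.log 2 + c * ∫ y, |y| ∂μ) := by
        gcongr
        exact natCast_mul_density_le hc N

/-- The densities of two diluted systems of sizes `m` and `n` that do not interact. -/
def blockDensity (c : ℝ) (m n : ℕ) (e : Pairs (m + n)) : ℝ :=
  if (e.1.2 : ℕ) < m then density c m else if m ≤ (e.1.1 : ℕ) then density c n else 0

variable {c : ℝ} {m n : ℕ}

lemma blockDensity_leftPair (p : Pairs m) : blockDensity c m n (leftPair n p) = density c m := by
  simp [blockDensity, mapPair]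

lemma blockDensity_rightPair (p : Pairs n) : blockDensity c m n (rightPair m p) = density c n := by
  simp [blockDensity, mapPair]

lemma blockDensity_eq_zero (p : Pairs (m + n)) (hp₁ : (p.1.1 : ℕ) < m) (hp₂ : m ≤ (p.1.2 : ℕ)) :
    blockDensity c m n p = 0 := by
  rw [blockDensity, if_neg hp₂.not_gt, if_neg hp₁.not_ge]

lemma blockDensity_mem_Icc (hc : 0 ≤ c) (e : Pairs (m + n)) :
    blockDensity c m n e ∈ Set.Icc (0 : ℝ) 1 := by
  unfold blockDensity
  split_ifs
  exacts [density_mem_Icc hc m, density_mem_Icc hc n, by simp]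

lemma integral_logZ_blockDensity {μ : Measure ℝ} [IsProbabilityMeasure μ] (hμ : Integrable id μ)
    (hc : 0 ≤ c) :
    ∫ x, logZ x ∂(Measure.pi fun e => dilute (blockDensity c m n e) μ) =
      dilutedMean μ c m + dilutedMean μ c n := by
  have := fun e : Pairs (m + n) =>
    isProbabilityMeasure_mixture (blockDensity_mem_Icc hc e) (Measure.dirac 0) μ
  rw [integral_logZ_eq_add _ (fun _ => integrable_id_dilute hμ _) fun p hp₁ hp₂ => by
    rw [blockDensity_eq_zero p hp₁ hp₂, dilute, mixture_zero]]
  simp only [blockDensity_leftPair, blockDensity_rightPair, dilutedMean]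

lemma sum_blockDensity_sq_le (hc : 0 ≤ c) :
    ∑ e : Pairs (m + n), blockDensity c m n e ^ 2 ≤ 2 * c ^ 2 := by
  rw [sum_pairs_add (fun e => blockDensity c m n e ^ 2) fun p hp₁ hp₂ => by
    rw [blockDensity_eq_zero p hp₁ hp₂, zero_pow two_ne_zero]]
  simp only [blockDensity_leftPair, blockDensity_rightPair, Finset.sum_const, Finset.card_univ,
    nsmul_eq_mul]
  linarith [card_pairs_mul_density_sq_le hc m, card_pairs_mul_density_sq_le hc n]

lemma sum_pairs_eq_half_sum {N : ℕ} (h : Fin N → Fin N → ℝ) (hsymm : ∀ i j, h i j = h j i)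
    (hdiag : ∀ i, h i i = 0) : ∑ p : Pairs N, h p.1.1 p.1.2 = (∑ i, ∑ j, h i j) / 2 := by
  have hpairs : ∑ p : Pairs N, h p.1.1 p.1.2 = ∑ i, ∑ j, if i < j then h i j else 0 := by
    rw [← Fintype.sum_prod_type' (f := fun i j => if i < j then h i j else 0), ← Finset.sum_filter]
    exact (Finset.sum_subtype (p := fun p : Fin N × Fin N => p.1 < p.2) _ (by simp)
      fun p => h p.1 p.2).symm
  have hswap : ∑ i, ∑ j, (if i < j then h i j else 0) = ∑ i, ∑ j, if j < i then h i j else 0 := by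
    rw [Finset.sum_comm]
    simp only [hsymm]
  have hsplit : ∑ i, ∑ j, h i j = ∑ i, ∑ j, (if i < j then h i j else 0) +
      ∑ i, ∑ j, if j < i then h i j else 0 := by
    simp only [← Finset.sum_add_distrib]
    refine Finset.sum_congr rfl fun i _ => Finset.sum_congr rfl fun j _ => ?_
    rcases lt_trichotomy i j with hij | rfl | hij
    · simp [hij, hij.not_gt]
    · simp [hdiag]
    · simp [hij, hij.not_gt]
  rw [hpairs, hsplit, ← hswap]
  ring

/-- Weights that are constant on the two blocks and sum to zero: merging the blocks changes the
densities by at least a negative multiple of `blockWeight m n i * blockWeight m n j`. -/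
def blockWeight (m n : ℕ) (i : Fin (m + n)) : ℝ := if (i : ℕ) < m then n else -m

lemma sum_blockWeight : ∑ i, blockWeight m n i = 0 := by
  simp [Fin.sum_univ_add, blockWeight, mul_comm]

lemma density_le_min_div {k N : ℕ} (h : k ≤ N) : density c k ≤ min c N / k := by
  unfold density
  gcongr

lemma blockDensity_le (hm : 0 < m) (hn : 0 < n) (e : Pairs (m + n)) :
    blockDensity c m n e ≤ density c (m + n) +
      min c (m + n : ℕ) / (m * n * (m + n)) *
        (blockWeight m n e.1.1 * blockWeight m n e.1.2) := by
  have hlt : (e.1.1 : ℕ) < e.1.2 := e.2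
  rw [density, Nat.cast_add]
  by_cases hleft : (e.1.2 : ℕ) < m
  · simp only [blockDensity, blockWeight, hleft, hlt.trans hleft, if_true]
    refine (density_le_min_div (Nat.le_add_right m n)).trans_eq ?_
    rw [Nat.cast_add]
    field_simp
  by_cases hright : m ≤ (e.1.1 : ℕ)
  · simp only [blockDensity, blockWeight, hleft, hright, hright.not_gt, if_true, if_false]
    refine (density_le_min_div (Nat.le_add_left n m)).trans_eq ?_
    rw [Nat.cast_add]
    field_simp
    ring
  · refine le_of_eq ?_
    simp only [blockDensity, blockWeight, not_le.1 hright, hright, hleft, if_true, if_false]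
    field_simp
    ring

lemma sum_sub_blockDensity_mul_gain_nonneg (hc : 0 ≤ c) (hm : 0 < m) (hn : 0 < n)
    (x : Pairs (m + n) → ℝ) (y : ℝ) :
    0 ≤ ∑ e, (density c (m + n) - blockDensity c m n e) * gain y (gibbs x e.1.1 e.1.2) := by
  set K : ℝ := min c (m + n : ℕ) / (m * n * (m + n))
  let w := blockWeight m n
  have hK0 : 0 ≤ K := div_nonneg (le_min hc (Nat.cast_nonneg _)) (by positivity)
  have hsum := sum_mul_gain_nonpos x w sum_blockWeight y
  calc 0 ≤ -K * ((∑ i, ∑ j, w i * w j * gain y (gibbs x i j)) / 2) := by nlinarith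
    _ = ∑ e : Pairs (m + n),
        -K * (w e.1.1 * w e.1.2 * gain y (gibbs x e.1.1 e.1.2)) := by
      rw [← Finset.mul_sum, sum_pairs_eq_half_sum fun i j => w i * w j * gain y (gibbs x i j)]
      · intro i j
        rw [gibbs_comm, mul_comm (w i)]
      · intro i
        rw [gibbs_self, gain_one, mul_zero]
    _ ≤ ∑ e, (density c (m + n) - blockDensity c m n e) * gain y (gibbs x e.1.1 e.1.2) := by
      refine Finset.sum_le_sum fun e _ => ?_
      rw [← mul_assoc]
      refine mul_le_mul_of_nonneg_right ?_ (gain_nonneg (abs_gibbs_le_one _ _ _) y)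
      linarith [blockDensity_le (c := c) hm hn e]

lemma dilutedMean_add_le {μ : Measure ℝ} [IsProbabilityMeasure μ] [μ.IsNegInvariant]
    (hμ : Integrable id μ) (hc : 0 ≤ c) (m n : ℕ) :
    dilutedMean μ c m + dilutedMean μ c n ≤
      dilutedMean μ c (m + n) + (∫ y, |y| ∂μ) * (3 * c ^ 2) := by
  have herr : 0 ≤ (∫ y, |y| ∂μ) * (3 * c ^ 2) := by positivity
  rcases m.eq_zero_or_pos with rfl | hm
  · rw [dilutedMean_zero μ hc, zero_add, zero_add]
    linarith
  rcases n.eq_zero_or_pos with rfl | hn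
  · rw [dilutedMean_zero μ hc, add_zero, add_zero]
    linarith
  have hsq : ∑ e : Pairs (m + n), (density c (m + n) ^ 2 + blockDensity c m n e ^ 2) ≤
      3 * c ^ 2 := by
    rw [Finset.sum_add_distrib, Finset.sum_const, Finset.card_univ, nsmul_eq_mul]
    linarith [card_pairs_mul_density_sq_le hc (m + n), sum_blockDensity_sq_le (m := m) (n := n) hc]
  rw [← integral_logZ_blockDensity hμ hc]
  refine (integral_logZ_dilute_le_add hμ (fun e => blockDensity_mem_Icc hc e)
    (fun _ => density_mem_Icc hc (m + n))
    (sum_sub_blockDensity_mul_gain_nonneg hc hm hn)).trans ?_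
  unfold dilutedMean
  gcongr

theorem exists_tendsto_dilutedMean {μ : Measure ℝ} [IsProbabilityMeasure μ] [μ.IsNegInvariant]
    (hμ : Integrable id μ) (hc : 0 ≤ c) :
    ∃ L, Tendsto (fun N : ℕ => dilutedMean μ c N / N) atTop (𝓝 L) := by
  set κ := ∫ y, |y| ∂μ
  have hκ : 0 ≤ κ := integral_nonneg fun _ => abs_nonneg _
  have hsub : Subadditive fun N => κ * (3 * c ^ 2) - dilutedMean μ c N := fun m n => by
    linarith [dilutedMean_add_le hμ hc m n]
  have hbdd : BddBelow (Set.range fun N : ℕ => (κ * (3 * c ^ 2) - dilutedMean μ c N) / N) := by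
    refine ⟨-(Real.log 2 + c * κ), ?_⟩
    rintro _ ⟨N, rfl⟩
    rcases N.eq_zero_or_pos with rfl | hN
    · simp only [Nat.cast_zero, div_zero, Left.neg_nonpos_iff]
      positivity
    · rw [le_div_iff₀ (Nat.cast_pos.2 hN)]
      nlinarith [dilutedMean_le hμ hc N, mul_nonneg hκ (sq_nonneg c)]
  have hconst : Tendsto (fun N : ℕ => κ * (3 * c ^ 2) / N) atTop (𝓝 0) :=
    tendsto_const_div_atTop_nhds_zero_nat _
  refine ⟨0 - hsub.lim, (hconst.sub (hsub.tendsto_lim hbdd)).congr fun N => ?_⟩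
  ring

end DilutedModel

/-! ### Symmetric laws with Pareto tails -/

section SymmetricLaws

lemma measurableSet_le_abs (t : ℝ) : MeasurableSet {y : ℝ | t ≤ |y|} :=
  measurableSet_le measurable_const measurable_abs

lemma lintegral_indicator_add_indicator_neg_map_abs (κ : Measure ℝ) [κ.IsNegInvariant]
    {B : Set ℝ} (hB : MeasurableSet B) :
    ∫⁻ t, B.indicator 1 t + B.indicator 1 (-t) ∂(κ.map abs) = 2 * κ B := by
  have hind : Measurable (B.indicator (1 : ℝ → ENNReal)) := measurable_one.indicator hB
  have habs : ∀ y : ℝ, B.indicator (1 : ℝ → ENNReal) |y| + B.indicator 1 (-|y|) =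
      B.indicator 1 y + B.indicator 1 (-y) := fun y => by
    rcases abs_choice y with h | h <;> rw [h]
    rw [neg_neg, add_comm]
  rw [lintegral_map (f := fun t => B.indicator 1 t + B.indicator 1 (-t))
    (hind.add (hind.comp measurable_neg)) measurable_abs]
  simp only [habs]
  rw [lintegral_add_left hind, (Measure.measurePreserving_neg κ).lintegral_comp hind,
    lintegral_indicator_one hB, two_mul]

lemma ext_of_map_abs_eq {κ κ' : Measure ℝ} [κ.IsNegInvariant] [κ'.IsNegInvariant]
    (h : κ.map abs = κ'.map abs) : κ = κ' := by
  ext B hB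
  have h₂ : 2 * κ B = 2 * κ' B := by
    rw [← lintegral_indicator_add_indicator_neg_map_abs κ hB, h,
      lintegral_indicator_add_indicator_neg_map_abs κ' hB]
  exact (ENNReal.mul_right_inj two_ne_zero ENNReal.ofNat_ne_top).1 h₂

lemma ext_of_tail_eq {κ κ' : Measure ℝ} [IsFiniteMeasure κ] [IsFiniteMeasure κ']
    [κ.IsNegInvariant] [κ'.IsNegInvariant]
    (h : ∀ t, κ.real {y | t ≤ |y|} = κ'.real {y | t ≤ |y|}) : κ = κ' := by
  refine ext_of_map_abs_eq (Measure.ext_of_Ici _ _ fun t => ?_)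
  rw [Measure.map_apply measurable_abs measurableSet_Ici,
    Measure.map_apply measurable_abs measurableSet_Ici]
  exact (measureReal_eq_measureReal_iff).1 (h t)

instance isNegInvariant_cond_le_abs (ν : Measure ℝ) [ν.IsNegInvariant] (δ : ℝ) :
    (ν[|{y | δ ≤ |y|}]).IsNegInvariant := by
  have h := ((Measure.measurePreserving_neg ν).restrict_preimage (measurableSet_le_abs δ)).map_eq
  simp only [Set.preimage_ofPred_eq, abs_neg] at h
  exact ⟨by rw [Measure.neg_def, ProbabilityTheory.cond, Measure.map_smul, h]⟩

instance isNegInvariant_map_const_mul (ν : Measure ℝ) [ν.IsNegInvariant] (a : ℝ) :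
    (ν.map (a * ·)).IsNegInvariant := by
  refine ⟨?_⟩
  conv_rhs => rw [← Measure.map_neg_eq_self ν]
  rw [Measure.neg_def, Measure.map_map measurable_neg (measurable_const_mul a),
    Measure.map_map (measurable_const_mul a) measurable_neg]
  congr 1
  ext y
  simp

lemma isNegInvariant_map {Ω : Type*} [MeasurableSpace Ω] {P : Measure Ω} {X : Ω → ℝ}
    (h : IdentDistrib X (fun ω => -X ω) P P) : (P.map X).IsNegInvariant :=
  ⟨(AEMeasurable.map_map_of_aemeasurable measurable_neg.aemeasurable h.aemeasurable_fst).trans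
    h.map_eq.symm⟩

end SymmetricLaws

section TailBounds

variable {ν : Measure ℝ} [IsProbabilityMeasure ν] {α D : ℝ}

lemma integrable_id_of_tail_le (hα : 1 < α)
    (h : ∀ t : ℝ, 0 < t → ν.real {y | t ≤ |y|} ≤ D * t ^ (-α)) : Integrable id ν := by
  refine (integrable_norm_iff aestronglyMeasurable_id).1
    ⟨measurable_id.norm.aestronglyMeasurable, ?_⟩
  rw [hasFiniteIntegral_iff_ofReal (Eventually.of_forall fun _ => norm_nonneg _),
    lintegral_eq_lintegral_meas_le ν (Eventually.of_forall fun _ => norm_nonneg _)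
      measurable_id.norm.aemeasurable, ← Set.Ioc_union_Ioi_eq_Ioi (zero_le_one' ℝ)]
  refine (lintegral_union_le _ _ _).trans_lt (ENNReal.add_lt_top.2 ⟨?_, ?_⟩)
  · calc ∫⁻ t in Set.Ioc (0 : ℝ) 1, ν {y | t ≤ ‖id y‖} ≤ ∫⁻ _t in Set.Ioc (0 : ℝ) 1, 1 :=
          lintegral_mono fun _ => prob_le_one
      _ < ⊤ := by simp
  · have hint := (integrableOn_Ioi_rpow_of_lt (neg_lt_neg hα) zero_lt_one).const_mul D
    refine (setLIntegral_mono' measurableSet_Ioi fun t ht => ?_).trans_lt hint.lintegral_lt_top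
    rw [← ofReal_measureReal]
    exact ENNReal.ofReal_le_ofReal (h t (zero_lt_one.trans ht))

lemma integral_le_of_tail_le {Ω : Type*} [MeasurableSpace Ω] {P : Measure Ω} [IsFiniteMeasure P]
    {f : Ω → ℝ} {a M : ℝ} (hf : Measurable f) (hf₀ : ∀ ω, 0 ≤ f ω) (hfM : ∀ ω, f ω ≤ M)
    (hM : 0 ≤ M) (ha : a < 1) (h : ∀ t ∈ Set.Ioc 0 M, P.real {ω | t ≤ f ω} ≤ D * t ^ (-a)) :
    ∫ ω, f ω ∂P ≤ D * (M ^ (1 - a) / (1 - a)) := by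
  have hfint : Integrable f P :=
    (integrable_const M).mono' hf.aestronglyMeasurable (Eventually.of_forall fun ω =>
      (Real.norm_of_nonneg (hf₀ ω)).trans_le (hfM ω))
  have hrpow : IntegrableOn (fun t : ℝ => D * t ^ (-a)) (Set.Ioc 0 M) := by
    rw [← intervalIntegrable_iff_integrableOn_Ioc_of_le hM]
    exact (intervalIntegral.intervalIntegrable_rpow' (by linarith)).const_mul D
  calc ∫ ω, f ω ∂P = ∫ t in Set.Ioc 0 M, P.real {ω | t ≤ f ω} :=
        hfint.integral_eq_integral_Ioc_meas_le (Eventually.of_forall hf₀) (Eventually.of_forall hfM)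
    _ ≤ ∫ t in Set.Ioc 0 M, D * t ^ (-a) :=
        integral_mono_of_nonneg (Eventually.of_forall fun _ => measureReal_nonneg) hrpow
          (ae_restrict_of_forall_mem measurableSet_Ioc h)
    _ = D * (M ^ (1 - a) / (1 - a)) := by
        rw [← intervalIntegral.integral_of_le hM, intervalIntegral.integral_const_mul,
          integral_rpow (Or.inl (by linarith)), Real.zero_rpow (by linarith), sub_zero,
          neg_add_eq_sub]

lemma setIntegral_sq_le_of_tail_le (hα : α < 2)
    (h : ∀ t : ℝ, 0 < t → ν.real {y | t ≤ |y|} ≤ D * t ^ (-α)) {δ : ℝ} (hδ : 0 < δ) :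
    ∫ y in {y | δ ≤ |y|}ᶜ, y ^ 2 ∂ν ≤ D * (δ ^ (2 - α) / (1 - α / 2)) := by
  have hA := (measurableSet_le_abs δ).compl
  let f : ℝ → ℝ := {y | δ ≤ |y|}ᶜ.indicator fun y => y ^ 2
  have hfδ : ∀ y, f y ≤ δ ^ 2 := Set.indicator_le' (fun y hy => by
    rw [← sq_abs]
    exact pow_le_pow_left₀ (abs_nonneg y) (by simpa using hy : |y| < δ).le 2) fun _ _ => sq_nonneg δ
  have htail : ∀ t ∈ Set.Ioc 0 (δ ^ 2), ν.real {y | t ≤ f y} ≤ D * t ^ (-(α / 2)) := fun t ht => by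
    have hsub : {y : ℝ | t ≤ f y} ⊆ {y | √t ≤ |y|} := fun y hy =>
      Real.sqrt_le_left (abs_nonneg y) |>.2 <| by
        rw [sq_abs]
        exact hy.trans (Set.indicator_le_self' (fun _ _ => sq_nonneg y) y)
    refine (measureReal_mono hsub).trans ((h _ (Real.sqrt_pos.2 ht.1)).trans_eq ?_)
    rw [Real.sqrt_eq_rpow, ← Real.rpow_mul ht.1.le]
    ring_nf
  calc ∫ y in {y | δ ≤ |y|}ᶜ, y ^ 2 ∂ν = ∫ y, f y ∂ν := (integral_indicator hA).symm
    _ ≤ D * ((δ ^ 2) ^ (1 - α / 2) / (1 - α / 2)) :=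
        integral_le_of_tail_le ((measurable_id.pow_const 2).indicator hA)
          (Set.indicator_nonneg fun y _ => sq_nonneg y) hfδ (sq_nonneg δ) (by linarith) htail
    _ = D * (δ ^ (2 - α) / (1 - α / 2)) := by
        rw [← Real.rpow_natCast δ 2, ← Real.rpow_mul hδ.le]
        ring_nf

end TailBounds

/-- The law `ν` has a two-sided Pareto tail beyond the threshold `s`: a variable of law `ν`
exceeds `t > s` in absolute value with probability `C / t ^ α`. -/
def HasParetoTail (ν : Measure ℝ) (α C s : ℝ) : Prop :=
  ∀ t, s < t → ν.real {y | t ≤ |y|} = C / t ^ α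

namespace HasParetoTail

variable {ν : Measure ℝ} {α C s : ℝ}

lemma of_real_eq {Ω : Type*} [MeasurableSpace Ω] {P : Measure Ω} {X : Ω → ℝ}
    (hX : AEMeasurable X P) (h : ∀ t, s < t → P.real {ω | t ≤ |X ω|} = C / t ^ α) :
    HasParetoTail (P.map X) α C s := fun t ht => by
  rw [← h t ht, map_measureReal_apply_of_aemeasurable hX (measurableSet_le_abs t)]
  rfl

lemma map_const_mul (h : HasParetoTail ν α C s) (hs : 0 ≤ s) {a : ℝ} (ha : 0 < a) :
    HasParetoTail (ν.map (a * ·)) α (C * a ^ α) (a * s) := fun t ht => by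
  have ht₀ : 0 < t := (mul_nonneg ha.le hs).trans_lt ht
  have hpre : (a * ·) ⁻¹' {y : ℝ | t ≤ |y|} = {y | t / a ≤ |y|} := by
    ext y
    simp only [Set.mem_preimage, Set.mem_ofPred_eq, abs_mul, abs_of_pos ha, div_le_iff₀' ha]
  rw [map_measureReal_apply (measurable_const_mul a) (measurableSet_le_abs t), hpre,
    h _ ((lt_div_iff₀' ha).2 ht), Real.div_rpow ht₀.le ha.le, div_div_eq_mul_div]

lemma cond_real_le_abs (h : HasParetoTail ν α C s) (hC : C ≠ 0) {δ : ℝ} (hδ₀ : 0 < δ)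
    (hδ : s < δ) (t : ℝ) :
    (ν[|{y | δ ≤ |y|}]).real {y | t ≤ |y|} = δ ^ α / max δ t ^ α := by
  have hinter : {y : ℝ | δ ≤ |y|} ∩ {y | t ≤ |y|} = {y | max δ t ≤ |y|} := by
    ext y
    simp only [Set.mem_inter_iff, Set.mem_ofPred_eq, max_le_iff]
  have hδα := (Real.rpow_pos_of_pos hδ₀ α).ne'
  have htα := (Real.rpow_pos_of_pos (lt_max_of_lt_left hδ₀ : 0 < max δ t) α).ne'
  rw [measureReal_def, cond_apply (measurableSet_le_abs δ), hinter, ENNReal.toReal_mul,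
    ENNReal.toReal_inv, ← measureReal_def, ← measureReal_def, h δ hδ,
    h _ (lt_max_of_lt_left hδ)]
  field_simp

lemma cond_eq_cond {ν' : Measure ℝ} {C' s' : ℝ} [ν.IsNegInvariant] [ν'.IsNegInvariant]
    (h : HasParetoTail ν α C s) (h' : HasParetoTail ν' α C' s') (hC : C ≠ 0) (hC' : C' ≠ 0)
    {δ : ℝ} (hδ₀ : 0 < δ) (hδ : s < δ) (hδ' : s' < δ) :
    ν[|{y | δ ≤ |y|}] = ν'[|{y | δ ≤ |y|}] :=
  ext_of_tail_eq fun t => by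
    rw [h.cond_real_le_abs hC hδ₀ hδ, h'.cond_real_le_abs hC' hδ₀ hδ']

variable [IsProbabilityMeasure ν]

lemma real_le_abs_le (h : HasParetoTail ν α C s) (hα : 0 ≤ α) (hC : 0 ≤ C) (hs : 0 ≤ s) (t : ℝ)
    (ht : 0 < t) : ν.real {y | t ≤ |y|} ≤ (s ^ α + C) * t ^ (-α) := by
  rw [Real.rpow_neg ht.le, ← div_eq_mul_inv]
  rcases lt_or_ge s t with hst | hts
  · rw [h t hst]
    gcongr
    exact le_add_of_nonneg_left (Real.rpow_nonneg hs α)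
  · refine measureReal_le_one.trans ((one_le_div (Real.rpow_pos_of_pos ht α)).2 ?_)
    exact (Real.rpow_le_rpow ht.le hts hα).trans (le_add_of_nonneg_right hC)

lemma integrable_id (h : HasParetoTail ν α C s) (hα : 1 < α) (hC : 0 ≤ C) (hs : 0 ≤ s) :
    Integrable id ν :=
  integrable_id_of_tail_le hα (h.real_le_abs_le (zero_le_one.trans hα.le) hC hs)

lemma setIntegral_sq_le (h : HasParetoTail ν α C s) (hα : 0 ≤ α) (hα' : α < 2) (hC : 0 ≤ C)
    (hs : 0 ≤ s) {δ : ℝ} (hδ : 0 < δ) :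
    ∫ y in {y | δ ≤ |y|}ᶜ, y ^ 2 ∂ν ≤ (s ^ α + C) * (δ ^ (2 - α) / (1 - α / 2)) :=
  setIntegral_sq_le_of_tail_le hα' (h.real_le_abs_le hα hC hs) hδ

end HasParetoTail

/-! ### Small couplings are negligible -/

section Truncation

variable {ν : Measure ℝ} [IsProbabilityMeasure ν]

lemma meanGain_dilute_cond {A : Set ℝ} (hν : Integrable id ν) (hA : ν A ≠ 0) {m : ℝ}
    (hm : |m| ≤ 1) :
    meanGain (dilute (ν.real A) ν[|A]) m = ∫ y in A, gain y m ∂ν := by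
  have := cond_isProbabilityMeasure hA
  have hcond : Integrable id ν[|A] := hν.restrict.smul_measure (ENNReal.inv_ne_top.2 hA)
  have hA' : ν.real A ≠ 0 := (measureReal_ne_zero_iff).2 hA
  rw [meanGain_dilute ⟨measureReal_nonneg, measureReal_le_one⟩ hcond hm, meanGain,
    ProbabilityTheory.cond, integral_smul_measure, ENNReal.toReal_inv, ← measureReal_def,
    smul_eq_mul, mul_inv_cancel_left₀ hA']

lemma integrableOn_sq_compl_le_abs (ν : Measure ℝ) [IsFiniteMeasure ν] (δ : ℝ) :
    IntegrableOn (fun y => y ^ 2) {y | δ ≤ |y|}ᶜ ν := by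
  refine Measure.integrableOn_of_bounded (M := δ ^ 2) (measure_ne_top ν _) (by fun_prop)
    (ae_restrict_of_forall_mem (measurableSet_le_abs δ).compl fun y hy => ?_)
  rw [norm_pow, Real.norm_eq_abs]
  exact pow_le_pow_left₀ (abs_nonneg y) (by simpa using hy : |y| < δ).le 2

lemma abs_meanGain_sub_dilute_cond_le (hν : Integrable id ν) {δ : ℝ} (hδ : ν {y | δ ≤ |y|} ≠ 0)
    {m : ℝ} (hm : |m| ≤ 1) :
    |meanGain ν m - meanGain (dilute (ν.real {y | δ ≤ |y|}) ν[|{y | δ ≤ |y|}]) m| ≤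
      (∫ y in {y | δ ≤ |y|}ᶜ, y ^ 2 ∂ν) / 2 := by
  have hgain := integrable_gain hν hm
  rw [meanGain_dilute_cond hν hδ hm, meanGain, ← integral_add_compl (measurableSet_le_abs δ) hgain,
    add_sub_cancel_left, abs_of_nonneg (integral_nonneg fun y => gain_nonneg hm y), ← integral_div]
  exact integral_mono hgain.restrict ((integrableOn_sq_compl_le_abs ν δ).div_const 2) fun y =>
    gain_le_half_sq hm y

lemma abs_integral_logZ_pi_sub_dilute_cond_le [ν.IsNegInvariant] (hν : Integrable id ν) {δ : ℝ}
    (hδ : ν {y | δ ≤ |y|} ≠ 0) (N : ℕ) :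
    |∫ x, logZ x ∂(Measure.pi fun _ : Pairs N => ν) - ∫ x, logZ x ∂(Measure.pi fun _ : Pairs N =>
        dilute (ν.real {y | δ ≤ |y|}) ν[|{y | δ ≤ |y|}])| ≤
      Fintype.card (Pairs N) * ((∫ y in {y | δ ≤ |y|}ᶜ, y ^ 2 ∂ν) / 2) := by
  set A := {y : ℝ | δ ≤ |y|}
  have := cond_isProbabilityMeasure hδ
  have := isProbabilityMeasure_mixture ⟨measureReal_nonneg, measureReal_le_one⟩
    (Measure.dirac 0) ν[|A] (t := ν.real A)
  have hdilute := integrable_id_dilute (hν.restrict.smul_measure (ENNReal.inv_ne_top.2 hδ))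
    (ν.real A) (μ := ν[|A])
  rw [abs_sub_le_iff, sub_le_iff_le_add', sub_le_iff_le_add']
  constructor
  · exact integral_logZ_pi_le_add_card_mul (fun _ => hν) (fun _ => hdilute) fun _ m hm => by
      linarith [le_of_abs_le (abs_meanGain_sub_dilute_cond_le hν hδ hm)]
  · exact integral_logZ_pi_le_add_card_mul (fun _ => hdilute) (fun _ => hν) fun _ m hm => by
      linarith [neg_le_of_abs_le (abs_meanGain_sub_dilute_cond_le hν hδ hm)]

end Truncation

/-! ### Convergence of the free energy -/

section FreeEnergy

lemma exists_tendsto_of_near_convergent {f : ℕ → ℝ}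
    (h : ∀ ε > 0, ∃ (u : ℕ → ℝ) (L : ℝ), Tendsto u atTop (𝓝 L) ∧ ∀ᶠ n in atTop, |f n - u n| ≤ ε) :
    ∃ L, Tendsto f atTop (𝓝 L) := by
  refine cauchySeq_tendsto_of_complete (Metric.cauchySeq_iff'.2 fun ε hε => ?_)
  obtain ⟨u, L, hu, hfu⟩ := h (ε / 4) (by positivity)
  have huL := hu.eventually (Metric.ball_mem_nhds L (show 0 < ε / 4 by positivity))
  obtain ⟨n₀, hn₀⟩ := eventually_atTop.1 (hfu.and huL)
  refine ⟨n₀, fun n hn => ?_⟩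
  obtain ⟨hfn, hun⟩ := hn₀ n hn
  obtain ⟨hfn₀, hun₀⟩ := hn₀ n₀ le_rfl
  rw [Real.dist_eq] at hun hun₀ ⊢
  rw [abs_le] at hfn hfn₀
  rw [abs_lt] at hun hun₀ ⊢
  constructor <;> linarith

/-- The law of `N ^ (-1/α) * Y` for `Y` of law `ρ`. -/
def scaledLaw (α : ℝ) (ρ : Measure ℝ) (N : ℕ) : Measure ℝ :=
  ρ.map (((N : ℝ) ^ (1 / α))⁻¹ * ·)

variable {ρ : Measure ℝ} {α C s : ℝ}

instance isProbabilityMeasure_scaledLaw [IsProbabilityMeasure ρ] (α : ℝ) (N : ℕ) :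
    IsProbabilityMeasure (scaledLaw α ρ N) :=
  Measure.isProbabilityMeasure_map (measurable_const_mul _).aemeasurable

instance isNegInvariant_scaledLaw [ρ.IsNegInvariant] (α : ℝ) (N : ℕ) :
    (scaledLaw α ρ N).IsNegInvariant :=
  isNegInvariant_map_const_mul ρ _

lemma integrable_id_scaledLaw (hρ : Integrable id ρ) (α : ℝ) (N : ℕ) :
    Integrable id (scaledLaw α ρ N) :=
  (integrable_map_measure aestronglyMeasurable_id (measurable_const_mul _).aemeasurable).2
    (hρ.const_mul _)

lemma inv_rpow_one_div_rpow (hα : α ≠ 0) (N : ℕ) : (((N : ℝ) ^ (1 / α))⁻¹) ^ α = (N : ℝ)⁻¹ := by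
  rw [Real.inv_rpow (by positivity), ← Real.rpow_mul N.cast_nonneg, one_div_mul_cancel hα,
    Real.rpow_one]

lemma HasParetoTail.scaledLaw (h : HasParetoTail ρ α C s) (hα : α ≠ 0) (hs : 0 ≤ s) {N : ℕ}
    (hN : 0 < N) : HasParetoTail (scaledLaw α ρ N) α (C / N) (((N : ℝ) ^ (1 / α))⁻¹ * s) := by
  have hscaled := h.map_const_mul hs (a := ((N : ℝ) ^ (1 / α))⁻¹) (by positivity)
  rwa [inv_rpow_one_div_rpow hα, ← div_eq_mul_inv] at hscaled

variable [IsProbabilityMeasure ρ] [ρ.IsNegInvariant]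

lemma abs_integral_logZ_scaledLaw_div_sub_le (h : HasParetoTail ρ α C s) (hα : 1 < α) (hα' : α < 2)
    (hC : 0 < C) (hs : 0 ≤ s) {δ : ℝ} (hδ : 0 < δ) {N : ℕ} (hN : 0 < N)
    (hNδ : ((N : ℝ) ^ (1 / α))⁻¹ * s < δ) :
    |(∫ x, logZ x ∂(Measure.pi fun _ : Pairs N => scaledLaw α ρ N)) / N -
        dilutedMean (scaledLaw α ρ N)[|{y | δ ≤ |y|}] (C / δ ^ α) N / N| ≤
      (s ^ α + C) / (2 - α) * δ ^ (2 - α) := by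
  set ν := scaledLaw α ρ N
  set a := ((N : ℝ) ^ (1 / α))⁻¹
  have hN₀ : (0 : ℝ) < N := Nat.cast_pos.2 hN
  have hα₀ : 0 < α := zero_lt_one.trans hα
  have htail : HasParetoTail ν α (C / N) (a * s) := h.scaledLaw hα₀.ne' hs hN
  have has : 0 ≤ a * s := by positivity
  have hp : ν.real {y | δ ≤ |y|} = C / δ ^ α / N := (htail δ hNδ).trans (div_right_comm _ _ _)
  have hpos : 0 < ν.real {y | δ ≤ |y|} := hp ▸ by positivity
  have hdensity : ν.real {y | δ ≤ |y|} = density (C / δ ^ α) N := by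
    rw [density_of_le ((div_le_one hN₀).1 (hp ▸ measureReal_le_one)), hp]
  have hcut := abs_integral_logZ_pi_sub_dilute_cond_le
    (htail.integrable_id hα (by positivity) has) ((measureReal_ne_zero_iff).1 hpos.ne') N
  have hsq := htail.setIntegral_sq_le hα₀.le hα' (by positivity) has hδ
  rw [Real.mul_rpow (by positivity) hs, inv_rpow_one_div_rpow hα₀.ne'] at hsq
  rw [hdensity] at hcut
  rw [← sub_div, abs_div, abs_of_pos hN₀, div_le_iff₀ hN₀]
  refine hcut.trans ?_
  calc Fintype.card (Pairs N) * ((∫ y in {y | δ ≤ |y|}ᶜ, y ^ 2 ∂ν) / 2)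
      ≤ (N : ℝ) ^ 2 * (((N : ℝ)⁻¹ * s ^ α + C / N) * (δ ^ (2 - α) / (1 - α / 2)) / 2) := by
        gcongr
        exacts [card_pairs_le N]
    _ = (s ^ α + C) / (2 - α) * δ ^ (2 - α) * N := by
        rw [show 1 - α / 2 = (2 - α) / 2 by ring]
        have : 2 - α ≠ 0 := by linarith
        field_simp

lemma exists_tendsto_near_integral_logZ_scaledLaw (h : HasParetoTail ρ α C s) (hα : 1 < α)
    (hα' : α < 2) (hC : 0 < C) (hs : 0 ≤ s) {δ : ℝ} (hδ : 0 < δ) :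
    ∃ (u : ℕ → ℝ) (L : ℝ), Tendsto u atTop (𝓝 L) ∧ ∀ᶠ N : ℕ in atTop,
      |(∫ x, logZ x ∂(Measure.pi fun _ : Pairs N => scaledLaw α ρ N)) / N - u N| ≤
        (s ^ α + C) / (2 - α) * δ ^ (2 - α) := by
  have hα₀ : 0 < α := zero_lt_one.trans hα
  have hscale : Tendsto (fun N : ℕ => ((N : ℝ) ^ (1 / α))⁻¹ * s) atTop (𝓝 0) := by
    simpa using ((tendsto_rpow_atTop (one_div_pos.2 hα₀)).comp
      tendsto_natCast_atTop_atTop).inv_tendsto_atTop.mul_const s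
  have hsmall := (eventually_gt_atTop 0).and (hscale.eventually_lt_const hδ)
  obtain ⟨N₀, hN₀, hN₀δ⟩ := hsmall.exists
  set μ := (scaledLaw α ρ N₀)[|{y | δ ≤ |y|}]
  have htail := fun {N : ℕ} (hN : 0 < N) => h.scaledLaw hα₀.ne' hs hN
  have hC' := fun {N : ℕ} (hN : 0 < N) => (div_pos hC (Nat.cast_pos.2 hN : (0 : ℝ) < N)).ne'
  have hδ₀ : scaledLaw α ρ N₀ {y | δ ≤ |y|} ≠ 0 := by
    rw [← measureReal_ne_zero_iff, htail hN₀ δ hN₀δ]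
    positivity
  have := cond_isProbabilityMeasure hδ₀
  have hμ : Integrable id μ :=
    (integrable_id_scaledLaw (h.integrable_id hα hC.le hs) α N₀).restrict.smul_measure
      (ENNReal.inv_ne_top.2 hδ₀)
  obtain ⟨L, hL⟩ := exists_tendsto_dilutedMean hμ (by positivity : 0 ≤ C / δ ^ α)
  refine ⟨_, L, hL, hsmall.mono fun N ⟨hN, hNδ⟩ => ?_⟩
  have hμN : (scaledLaw α ρ N)[|{y | δ ≤ |y|}] = μ :=
    (htail hN).cond_eq_cond (htail hN₀) (hC' hN) (hC' hN₀) hδ hNδ hN₀δ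
  rw [← hμN]
  exact abs_integral_logZ_scaledLaw_div_sub_le h hα hα' hC hs hδ hN hNδ

theorem exists_tendsto_integral_logZ_scaledLaw (h : HasParetoTail ρ α C s) (hα : 1 < α)
    (hα' : α < 2) (hC : 0 < C) (hs : 0 ≤ s) :
    ∃ F, Tendsto (fun N : ℕ =>
      (∫ x, logZ x ∂(Measure.pi fun _ : Pairs N => scaledLaw α ρ N)) / N) atTop (𝓝 F) := by
  refine exists_tendsto_of_near_convergent fun ε hε => ?_
  have h2α : 0 < 2 - α := by linarith
  have hlim : Tendsto (fun δ : ℝ => (s ^ α + C) / (2 - α) * δ ^ (2 - α)) (𝓝[>] 0) (𝓝 0) := by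
    have hcont := (Real.continuous_rpow_const h2α.le).tendsto 0
    rw [Real.zero_rpow h2α.ne'] at hcont
    simpa using (hcont.mono_left nhdsWithin_le_nhds).const_mul ((s ^ α + C) / (2 - α))
  obtain ⟨δ, hδε, hδ⟩ := ((hlim.eventually_lt_const hε).and self_mem_nhdsWithin).exists
  obtain ⟨u, L, hu, hfu⟩ := exists_tendsto_near_integral_logZ_scaledLaw h hα hα' hC hs hδ
  exact ⟨u, L, hu, hfu.mono fun N hN => hN.trans hδε.le⟩

section Couplings

variable {N : ℕ} {Ω : Type*} [MeasurableSpace Ω] {P : Measure Ω} {J : Pairs N → Ω → ℝ} {β : ℝ}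
  {ρ : Measure ℝ} (hJ : ∀ p, AEMeasurable (J p) P) (hindep : iIndepFun J P)
  (hlaw : ∀ p, P.map (fun ω => β * J p ω) = ρ) (α : ℝ)

include hJ

lemma aemeasurable_scaled :
    AEMeasurable (fun ω p => ((N : ℝ) ^ (1 / α))⁻¹ * (β * J p ω)) P :=
  aemeasurable_pi_lambda _ fun p => ((hJ p).const_mul _).const_mul _

include hindep hlaw

lemma map_scaled_eq_pi :
    P.map (fun ω p => ((N : ℝ) ^ (1 / α))⁻¹ * (β * J p ω)) =
      Measure.pi fun _ : Pairs N => scaledLaw α ρ N := by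
  have := hindep.isProbabilityMeasure
  have hscaled := hindep.comp (fun _ y => ((N : ℝ) ^ (1 / α))⁻¹ * (β * y)) fun _ => by fun_prop
  refine ((iIndepFun_iff_map_fun_eq_pi_map fun p =>
    ((hJ p).const_mul _).const_mul _).1 hscaled).trans ?_
  congr 1
  ext1 p
  rw [scaledLaw, ← hlaw p, AEMeasurable.map_map_of_aemeasurable
    (measurable_const_mul _).aemeasurable ((hJ p).const_mul β)]
  rfl

lemma integrable_log_partitionFunction [IsProbabilityMeasure ρ] (hρ : Integrable id ρ) :
    Integrable (fun ω => Real.log (partitionFunction α β fun p => J p ω)) P := by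
  have h := integrable_logZ fun _ : Pairs N => integrable_id_scaledLaw hρ α N
  rw [← map_scaled_eq_pi hJ hindep hlaw α, integrable_map_measure
    continuous_logZ.aestronglyMeasurable (aemeasurable_scaled hJ α)] at h
  simp only [log_partitionFunction]
  exact h

lemma freeEnergy_eq_integral_logZ_div :
    freeEnergy α β P J =
      (∫ x, logZ x ∂(Measure.pi fun _ : Pairs N => scaledLaw α ρ N)) / N := by
  rw [← map_scaled_eq_pi hJ hindep hlaw α,
    integral_map (aemeasurable_scaled hJ α) continuous_logZ.aestronglyMeasurable]
  simp only [freeEnergy, log_partitionFunction, one_div_mul_eq_div]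

end Couplings

end FreeEnergy

end HeavyTailedSpinGlass

end

theorem theorem1
    (α β C₀ : ℝ) (hα : 1 < α) (hα' : α < 2) (hβ : 0 < β) (hC₀ : 0 < C₀)
    -- the reference variable `J₀`: symmetric, with exact power law tail
    {Ω₀ : Type*} [MeasurableSpace Ω₀] (P₀ : Measure Ω₀) [IsProbabilityMeasure P₀]
    (J₀ : Ω₀ → ℝ)
    (hsymm : IdentDistrib J₀ (fun ω => -J₀ ω) P₀ P₀)
    (htail : ∀ t : ℝ, 1 < t → P₀.real {ω | t ≤ |J₀ ω|} = C₀ / t ^ α)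
    -- for each `N`, i.i.d. couplings `J N p`, `p = (i, j)` with `i < j`, distributed as `J₀`
    {Ω : ℕ → Type*} [∀ N, MeasurableSpace (Ω N)] (P : ∀ N, Measure (Ω N))
    [∀ N, IsProbabilityMeasure (P N)]
    (J : ∀ N, HeavyTailedSpinGlass.Pairs N → Ω N → ℝ)
    (hindep : ∀ N, iIndepFun (J N) (P N))
    (hdist : ∀ N p, IdentDistrib (J N p) J₀ (P N) P₀) :
    (∀ N, Integrable
      (fun ω => Real.log (HeavyTailedSpinGlass.partitionFunction α β (fun p => J N p ω)))
      (P N)) ∧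
    ∃ F : ℝ, Tendsto (fun N => HeavyTailedSpinGlass.freeEnergy α β (P N) (J N)) atTop (𝓝 F) := by
  have hJ₀ : AEMeasurable J₀ P₀ := hsymm.aemeasurable_fst
  have hJ : ∀ N p, AEMeasurable (J N p) (P N) := fun N p => (hdist N p).aemeasurable_fst
  have : IsProbabilityMeasure (P₀.map J₀) := Measure.isProbabilityMeasure_map hJ₀
  have : (P₀.map J₀).IsNegInvariant := HeavyTailedSpinGlass.isNegInvariant_map hsymm
  let ρ : Measure ℝ := (P₀.map J₀).map (β * ·)
  have : IsProbabilityMeasure ρ :=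
    Measure.isProbabilityMeasure_map (measurable_const_mul β).aemeasurable
  have hlaw : ∀ N p, (P N).map (fun ω => β * J N p ω) = ρ := fun N p => by
    simp only [ρ, ← (hdist N p).map_eq]
    exact (AEMeasurable.map_map_of_aemeasurable (by fun_prop) (hJ N p)).symm
  have htailρ : HeavyTailedSpinGlass.HasParetoTail ρ α (C₀ * β ^ α) (β * 1) :=
    (HeavyTailedSpinGlass.HasParetoTail.of_real_eq hJ₀ htail).map_const_mul zero_le_one hβ
  have hC : 0 < C₀ * β ^ α := by positivity
  have hs : 0 ≤ β * 1 := by positivity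
  refine ⟨fun N => HeavyTailedSpinGlass.integrable_log_partitionFunction (hJ N) (hindep N)
    (hlaw N) α (htailρ.integrable_id hα hC.le hs), ?_⟩
  simp only [HeavyTailedSpinGlass.freeEnergy_eq_integral_logZ_div (hJ _) (hindep _) (hlaw _) α]
  exact HeavyTailedSpinGlass.exists_tendsto_integral_logZ_scaledLaw htailρ hα hα' hC hs
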